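/- Let $[k]=\{1,\dots,k\}$, let $\Delta_k\subset\mathbb{R}^k$ be the set of probability distributions on $[k]$, and for $q\in\mathbb{R}^k$ let $C(q)=\sum_{x} q_x^2$. A distribution estimator $A$ with $n$ users is a protocol with finitely many rounds between a server and $n$ users, where user $i$ holds $x_i\in[k]$ (each message takes values in a standard Borel space, is sent by one user or by the server, and has a law depending only on the earlier messages and, if user $i$ sends it, on $x_i$), followed by an estimate $A(x_1,\dots,x_n)\in\mathbb{R}^k$ that is a measurable function of the transcript of all messages. It is $(\alpha,\beta)$-locally differentially private (LDP) if, for all samples and every measurable set $O$ of transcripts, changing the sample of one user changes the probability $P$ of $O$ to some $P'$ with $P\le e^{\alpha}P'+\beta$. Its worst-case risk is $R(A)=\sup_{\mathbf p\in\Delta_k}\mathbb{E}\,\|A(x_1,\dots,x_n)-\mathbf p\|_1$, where $x_1,\dots,x_n$ are drawn independently from $\mathbf p$. The $k$-RAPPOR estimator $A^*_n$: each user $i$ sends $\hat v_i\in\{0,1\}^k$, obtained from the indicator vector of $x_i$ by flipping each bit independently with probability $\frac{1}{e^{\alpha/2}+1}$; the estimate is $\tilde p_x=\frac{e^{\alpha/2}+1}{e^{\alpha/2}-1}\cdot\frac1n\sum_{i}\hat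 v_{i,x}-\frac{1}{e^{\alpha/2}-1}$ for $x\in[k]$. There are universal constants $K,c>0$ such that for all $\alpha\in(0,1)$ and all $k\ge2$: 1. $k$-RAPPOR is $(\alpha,0)$-minimax optimal up to the constant factor $K$: it is $(\alpha,0)$-LDP; for every $n\ge1$ and every $(\alpha,0)$-LDP estimator $B$ with $n$ users, $\min\{2,R(A^*_n)\}\le K\,R(B)$; and for every $\tau\in(0,\frac12]$, if some $(\alpha,0)$-LDP estimator with $m$ users has worst-case risk at most $\tau$, then $R(A^*_n)\le\tau$ for all $n\ge Km$. 2. For the uniform distribution $\mathbf p\in\Delta_k$, all $n\ge1$ and all $\varepsilon>0$: if $x_1,\dots,x_n$ are drawn independently from $\mathbf p$ and $\mathbb{E}\left[\left|C(A^*_n(x_1,\dots,x_n))-C(\mathbf p)\right|\right]\le\varepsilon$, then $n\ge c\,\min\left\{\frac{k^2}{\alpha^2},\frac{k}{\alpha^2\varepsilon}\right\}$. -/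

import Mathlib

open MeasureTheory ProbabilityTheory
open scoped ENNReal

noncomputable section

namespace LDP

/-- A (fully interactive) local protocol in which `n` users, each holding one sample from
`[k] = Fin k`, communicate with a server, followed by an estimator of a vector indexed by `[k]`.

The protocol runs for finitely many rounds. In round `r` the message is sent by the user `i` if
`speaker r = some i`, and by the server if `speaker r = none`; its law may depend on all earlier
messages and, if it is sent by user `i`, on the sample of user `i`, but on no other sample. (Allowing
`Msg` to contain an empty message, this covers protocols whose schedule is adaptive; randomness
shared by the users is a message of the server.) The server estimates from the whole transcript. -/
structure Protocol (k n : ℕ) where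
  /-- number of rounds -/
  rounds : ℕ
  /-- the message space -/
  Msg : Type
  [mMsg : MeasurableSpace Msg]
  [borelMsg : StandardBorelSpace Msg]
  /-- who sends the message of a round; `none` is the server -/
  speaker : ℕ → Option (Fin n)
  /-- law of the message of round `r` given the messages of rounds `0, …, r - 1`, when the sender
  holds the sample `some x`, or is the server (`none`) -/
  step : (r : ℕ) → Option (Fin k) → Kernel (Fin r → Msg) Msg
  markov : ∀ r o, IsMarkovKernel (step r o)
  /-- the estimate, a function of the transcript -/
  est : (Fin rounds → Msg) → (Fin k → ℝ)
  measurable_est : Measurable est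

attribute [instance] Protocol.mMsg Protocol.borelMsg Protocol.markov

namespace Protocol

variable {k n : ℕ}

/-- The law of the messages of the first `r` rounds when the samples of the users are `x`. -/
def lawUpTo (A : Protocol k n) (x : Fin n → Fin k) : (r : ℕ) → Measure (Fin r → A.Msg)
  | 0 => Measure.dirac Fin.elim0
  | r + 1 => (A.lawUpTo x r ⊗ₘ A.step r ((A.speaker r).map x)).map
      (fun hm => (Fin.snoc hm.1 hm.2 : Fin (r + 1) → A.Msg))

/-- The law of the entire transcript when the samples of the users are `x`. -/
def law (A : Protocol k n) (x : Fin n → Fin k) : Measure (Fin A.rounds → A.Msg) :=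
  A.lawUpTo x A.rounds

/-- `(α, β)`-local differential privacy: changing the sample of one user changes the law of the
entire transcript only slightly. -/
def IsLDP (A : Protocol k n) (α β : ℝ) : Prop :=
  ∀ (x : Fin n → Fin k) (i : Fin n) (y : Fin k) (O : Set (Fin A.rounds → A.Msg)),
    MeasurableSet O →
      A.law x O ≤ ENNReal.ofReal (Real.exp α) * A.law (Function.update x i y) O
        + ENNReal.ofReal β

/-- The law of the transcript when the samples of the users are drawn independently from `p`. -/
def lawUnder (A : Protocol k n) (p : Fin k → ℝ) : Measure (Fin A.rounds → A.Msg) :=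
  ∑ x : Fin n → Fin k, (∏ i, ENNReal.ofReal (p (x i))) • A.law x

/-- The expected `ℓ₁` error of the estimate when the samples are drawn independently from `p`. -/
def risk (A : Protocol k n) (p : Fin k → ℝ) : ℝ≥0∞ :=
  ∫⁻ t, ENNReal.ofReal (∑ x, |A.est t x - p x|) ∂(A.lawUnder p)

/-- The maximum of the expected `ℓ₁` error over all distributions `p` on `[k]`. -/
def worstRisk (A : Protocol k n) : ℝ≥0∞ :=
  ⨆ p ∈ stdSimplex ℝ (Fin k), A.risk p

end Protocol

/-- The collision probability `C(q) = ∑ x, q x ^ 2`. -/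
def collision {k : ℕ} (q : Fin k → ℝ) : ℝ := ∑ x, q x ^ 2

/-- The expected error of the plug-in estimate of the collision probability of `p` when the samples
are drawn independently from `p`. -/
def Protocol.collisionError {k n : ℕ} (A : Protocol k n) (p : Fin k → ℝ) : ℝ≥0∞ :=
  ∫⁻ t, ENNReal.ofReal |collision (A.est t) - collision p| ∂(A.lawUnder p)

/-- The distribution estimator `A`, given for each number `n` of users, is `(α, β)`-minimax optimal
up to the constant factor `K`, among all `(α, β)`-locally differentially private estimators:

* it is `(α, β)`-locally differentially private;
* for each `n ≥ 1`, its worst-case risk, capped at the `ℓ₁`-diameter `2` of the simplex, is at most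
  `K` times that of any competitor;
* for each accuracy `0 < τ ≤ 1 / 2`, it needs at most `K` times as many users as any competitor
  in order to have worst-case risk at most `τ`. -/
structure IsMinimaxOptimalWithin {k : ℕ} (K α β : ℝ) (A : (n : ℕ) → Protocol k n) : Prop where
  isLDP : ∀ n, (A n).IsLDP α β
  risk_le : ∀ n : ℕ, 1 ≤ n → ∀ B : Protocol k n, B.IsLDP α β →
    min 2 (A n).worstRisk ≤ ENNReal.ofReal K * B.worstRisk
  samples_le : ∀ τ : ℝ, 0 < τ → τ ≤ 1 / 2 → ∀ (m : ℕ) (B : Protocol k m), B.IsLDP α β →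
    B.worstRisk ≤ ENNReal.ofReal τ →
      ∀ n : ℕ, K * m ≤ n → (A n).worstRisk ≤ ENNReal.ofReal τ

/-- The law of the bit `b` after it is flipped with probability `1 / (e ^ (α / 2) + 1)`. -/
def flipLaw (α : ℝ) (b : Bool) : Measure Bool :=
  ENNReal.ofReal (Real.exp (α / 2) / (Real.exp (α / 2) + 1)) • Measure.dirac b
    + ENNReal.ofReal (1 / (Real.exp (α / 2) + 1)) • Measure.dirac (!b)

instance (α : ℝ) (b : Bool) : IsProbabilityMeasure (flipLaw α b) := by
  constructor
  have h : 0 < Real.exp (α / 2) := Real.exp_pos _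
  simp only [flipLaw, Measure.add_apply, Measure.smul_apply, measure_univ, smul_eq_mul, mul_one]
  rw [← ENNReal.ofReal_add (by positivity) (by positivity), ← add_div, div_self (by positivity),
    ENNReal.ofReal_one]

/-- The law of the message of a user with sample `x`: the bits of the indicator vector of `x`
are flipped independently. -/
def rapporMsg (α : ℝ) {k : ℕ} (x : Fin k) : Measure (Fin k → Bool) :=
  Measure.pi fun y => flipLaw α (decide (y = x))

instance (α : ℝ) {k : ℕ} (x : Fin k) : IsProbabilityMeasure (rapporMsg α x) := by
  unfold rapporMsg; infer_instance

/-- The `k`-RAPPOR estimator. Each user once sends a noisy version of the indicator vector of its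
sample, whatever the others sent (the server sends nothing, so the value at `none` is never used).
The estimate is `a * phat - b`, where `phat` is the average of the messages. -/
def kRappor (α : ℝ) (k n : ℕ) : Protocol k n where
  rounds := n
  Msg := Fin k → Bool
  speaker r := if h : r < n then some ⟨r, h⟩ else none
  step r o := Kernel.const _ (o.elim (Measure.dirac fun _ => false) fun x => rapporMsg α x)
  markov r o := by cases o <;> (dsimp only [Option.elim]; infer_instance)
  est t y :=
    (Real.exp (α / 2) + 1) / (Real.exp (α / 2) - 1)
        * ((∑ i, if t i y then (1 : ℝ) else 0) / n)
      - 1 / (Real.exp (α / 2) - 1)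
  measurable_est := measurable_of_finite _

/-- The uniform distribution on `[k]`. -/
def uniform (k : ℕ) : Fin k → ℝ := fun _ => 1 / k

end LDP

end

/-!
Lower bound: a locally private transcript has a density that is a product, over the users, of
factors depending on one sample each, and by privacy two values of the same sample give
likelihoods within a factor `exp α`. Moving the sample distribution by `δ` in `ℓ₁` therefore costs
at most about `n (exp α - 1)² δ²` in squared Hellinger distance: in the expansion of the likelihood
ratio the first-order terms are changes of the density in one user's distribution, which integrate
to `0`, so only `n` second-order terms remain although the protocol is interactive. Assouad's lemma
on the cube of distributions obtained by tilting `k / 2` pairs of elements by `± γ / k` then gives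
`ℓ₁` risk of order `min 1 (k / (α √n))`.

Upper bound: each coordinate of the RAPPOR estimate is unbiased with variance of order
`1 / (α² n)`. The square root of the variance bounds the `ℓ₁` risk, and the variance itself is the
bias of the plug-in estimate of the collision probability.
-/

namespace LDP

open scoped NNReal

theorem measurable_snoc (r : ℕ) (M : Type*) [MeasurableSpace M] :
    Measurable (fun hm : (Fin r → M) × M => (Fin.snoc hm.1 hm.2 : Fin (r + 1) → M)) := by
  refine measurable_pi_lambda _ fun i => ?_
  refine Fin.lastCases ?_ (fun j => ?_) i
  · simpa using measurable_snd
  · simp only [Fin.snoc_castSucc]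
    exact (measurable_pi_apply j).comp measurable_fst

theorem measurable_unsnoc (r : ℕ) (M : Type*) [MeasurableSpace M] :
    Measurable (fun t : Fin (r + 1) → M => ((fun i => t i.castSucc : Fin r → M), t (Fin.last r))) :=
  (measurable_pi_lambda _ fun _ => measurable_pi_apply _).prodMk (measurable_pi_apply _)

theorem map_withDensity_of_leftInverse {X Y : Type*} [MeasurableSpace X] [MeasurableSpace Y]
    (μ : Measure X) {φ : X → Y} {ψ : Y → X} (hφ : Measurable φ) (hψ : Measurable ψ)
    (hψφ : Function.LeftInverse ψ φ) {g : X → ℝ≥0∞} (hg : Measurable g) :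
    (μ.withDensity g).map φ = (μ.map φ).withDensity (g ∘ ψ) := by
  ext s hs
  rw [Measure.map_apply hφ hs, withDensity_apply _ (hφ hs), withDensity_apply _ hs,
    setLIntegral_map hs (hg.comp hψ) hφ]
  simp only [Function.comp_apply, hψφ _]

theorem withDensity_compProd {X Y : Type*} [MeasurableSpace X] [MeasurableSpace Y] (μ : Measure X)
    [SFinite μ] (κ : Kernel X Y) [IsSFiniteKernel κ] {g : X → ℝ≥0∞} (hg : Measurable g) :
    μ.withDensity g ⊗ₘ κ = (μ ⊗ₘ κ).withDensity fun p => g p.1 := by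
  have hg' : Measurable fun p : X × Y => g p.1 := hg.comp measurable_fst
  refine Measure.ext_of_lintegral _ fun φ hφ => ?_
  rw [Measure.lintegral_compProd hφ,
    lintegral_withDensity_eq_lintegral_mul _ hg hφ.lintegral_kernel_prod_right',
    lintegral_withDensity_eq_lintegral_mul _ hg' hφ,
    Measure.lintegral_compProd (hg'.mul hφ)]
  refine lintegral_congr fun x => ?_
  exact (lintegral_const_mul (g x) (hφ.comp measurable_prodMk_left)).symm

theorem exists_kernel_eq_withDensity {H M κ : Type*} [MeasurableSpace H] [MeasurableSpace M]
    [MeasurableSpace.CountableOrCountablyGenerated H M] [Finite κ] (step : κ → Kernel H M)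
    [∀ x, IsFiniteKernel (step x)] :
    ∃ (η : Kernel H M) (_ : IsFiniteKernel η) (d : κ → H → M → ℝ≥0),
      (∀ x, Measurable (Function.uncurry (d x))) ∧
        ∀ x, step x = η.withDensity fun h m => d x h m := by
  have := Fintype.ofFinite κ
  have hfin : IsFiniteKernel (∑ x, step x) := by
    refine ⟨∑ x, (step x).bound, ENNReal.sum_lt_top.2 fun x _ => (step x).bound_lt_top,
      fun h => ?_⟩
    rw [_root_.sum_apply, Measure.finsetSum_apply]
    exact Finset.sum_le_sum fun x _ => Kernel.measure_le_bound _ _ _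
  refine ⟨∑ x, step x, hfin, fun x h m => (Kernel.rnDeriv (step x) (∑ x, step x) h m).toNNReal,
    fun x => (Kernel.measurable_rnDeriv _ _).ennreal_toNNReal, fun x => ?_⟩
  ext1 h
  have hac : step x h ≪ (∑ x, step x) h := by
    refine Measure.absolutelyContinuous_of_le ?_
    rw [_root_.sum_apply]
    exact Finset.single_le_sum (f := fun x => step x h) (fun _ _ => Measure.zero_le _)
      (Finset.mem_univ x)
  rw [Kernel.withDensity_apply _
      (Kernel.measurable_rnDeriv _ _).ennreal_toNNReal.coe_nnreal_ennreal,
    ← Kernel.withDensity_rnDeriv_eq hac, Kernel.withDensity_apply _ (Kernel.measurable_rnDeriv _ _)]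
  refine withDensity_congr_ae ?_
  filter_upwards [Kernel.rnDeriv_ne_top (step x) (∑ x, step x) (a := h)] with m hm
  exact (ENNReal.coe_toNNReal hm).symm

/-- The densities, with respect to `ν`, of the laws `μ x` of a transcript factor over the users:
`f i y` is the contribution of user `i` when its sample is `y`. -/
structure HasProductDensity {ι κ T : Type*} [Fintype ι] [MeasurableSpace T]
    (μ : (ι → κ) → Measure T) (ν : Measure T) (f : ι → κ → T → ℝ≥0) : Prop where
  measurable : ∀ i y, Measurable (f i y)
  eq_withDensity : ∀ x, μ x = ν.withDensity fun t => ((∏ i, f i (x i) t : ℝ≥0) : ℝ≥0∞)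

theorem HasProductDensity.measurable_prod {ι κ T : Type*} [Fintype ι] [MeasurableSpace T]
    {μ : (ι → κ) → Measure T} {ν : Measure T} {f : ι → κ → T → ℝ≥0} (h : HasProductDensity μ ν f)
    (x : ι → κ) : Measurable fun t => ((∏ i, f i (x i) t : ℝ≥0) : ℝ≥0∞) :=
  (Finset.measurable_fun_prod _ fun i _ => h.measurable i (x i)).coe_nnreal_ennreal

theorem HasProductDensity.map_snoc_compProd {ι κ M : Type*} [Fintype ι] [MeasurableSpace M] {r : ℕ}
    {μ : (ι → κ) → Measure (Fin r → M)} {ν : Measure (Fin r → M)} [SFinite ν]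
    {f : ι → κ → (Fin r → M) → ℝ≥0} (h : HasProductDensity μ ν f)
    {step : (ι → κ) → Kernel (Fin r → M) M} {η : Kernel (Fin r → M) M} [IsSFiniteKernel η]
    {d : ι → κ → (Fin r → M) → M → ℝ≥0} (hd : ∀ i y, Measurable (Function.uncurry (d i y)))
    (hstep : ∀ x, step x = η.withDensity fun t m => ((∏ i, d i (x i) t m : ℝ≥0) : ℝ≥0∞)) :
    HasProductDensity
      (fun x => (μ x ⊗ₘ step x).map fun hm => (Fin.snoc hm.1 hm.2 : Fin (r + 1) → M))
      ((ν ⊗ₘ η).map fun hm => (Fin.snoc hm.1 hm.2 : Fin (r + 1) → M))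
      fun i y t =>
        f i y (fun j => t j.castSucc) * d i y (fun j => t j.castSucc) (t (Fin.last r)) := by
  have hunsnoc := measurable_unsnoc r M
  refine ⟨fun i y => ((h.measurable i y).comp hunsnoc.fst).mul ((hd i y).comp hunsnoc), fun x => ?_⟩
  have hf := h.measurable_prod x
  have hdx : Measurable fun p : (Fin r → M) × M => ((∏ i, d i (x i) p.1 p.2 : ℝ≥0) : ℝ≥0∞) :=
    (Finset.measurable_fun_prod _ fun i _ => hd i (x i)).coe_nnreal_ennreal
  have hfst : Measurable fun p : (Fin r → M) × M => ((∏ i, f i (x i) p.1 : ℝ≥0) : ℝ≥0∞) :=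
    hf.comp measurable_fst
  rw [hstep, h.eq_withDensity, Measure.compProd_withDensity hdx, withDensity_compProd ν η hf,
    ← withDensity_mul _ hfst hdx, map_withDensity_of_leftInverse _ (measurable_snoc r M) hunsnoc
      (fun hm => by simp) (hfst.mul hdx)]
  congr 1
  ext t
  simp [Finset.prod_mul_distrib]

theorem Protocol.exists_hasProductDensity {k n : ℕ} (A : Protocol k n) (r : ℕ) :
    ∃ (ν : Measure (Fin r → A.Msg)) (_ : IsFiniteMeasure ν)
      (f : Fin n → Fin k → (Fin r → A.Msg) → ℝ≥0),
      HasProductDensity (fun x => A.lawUpTo x r) ν f := by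
  induction r with
  | zero =>
    exact ⟨Measure.dirac Fin.elim0, inferInstance, fun _ _ _ => 1, fun _ _ => measurable_const,
      fun _ => by simp [Protocol.lawUpTo]⟩
  | succ r ih =>
    obtain ⟨ν, hν, f, hf⟩ := ih
    cases hs : A.speaker r with
    | none =>
      have h := hf.map_snoc_compProd (step := fun _ => A.step r none) (η := A.step r none)
        (d := fun _ _ _ _ => 1) (fun _ _ => measurable_const) (fun _ => by simp)
      exact ⟨_, inferInstance, _, by simpa only [Protocol.lawUpTo, hs, Option.map_none] using h⟩
    | some j =>
      obtain ⟨η, hη, d, hd, hstep⟩ := exists_kernel_eq_withDensity fun y => A.step r (some y)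
      have h := hf.map_snoc_compProd (step := fun x => A.step r (some (x j))) (η := η)
        (d := fun i y t m => if i = j then d y t m else 1)
        (fun i y => by
          by_cases hi : i = j
          · simpa only [hi, if_true] using hd y
          · simp only [hi, if_false]
            exact measurable_const)
        (fun x => by simp [hstep])
      exact ⟨_, inferInstance, _, by simpa only [Protocol.lawUpTo, hs, Option.map_some] using h⟩

instance Protocol.isProbabilityMeasure_lawUpTo {k n : ℕ} (A : Protocol k n) (x : Fin n → Fin k)
    (r : ℕ) : IsProbabilityMeasure (A.lawUpTo x r) := by
  induction r with
  | zero => unfold Protocol.lawUpTo; infer_instance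
  | succ r ih =>
    unfold Protocol.lawUpTo
    exact Measure.isProbabilityMeasure_map (measurable_snoc r _).aemeasurable

instance Protocol.isProbabilityMeasure_law {k n : ℕ} (A : Protocol k n) (x : Fin n → Fin k) :
    IsProbabilityMeasure (A.law x) :=
  A.isProbabilityMeasure_lawUpTo x A.rounds

section Mixture

variable {ι κ T : Type*} [Fintype ι] [Fintype κ]

/-- The law of a transcript when the samples of the users are drawn independently, that of user `i`
from the distribution `w i`, and `μ x` is the law of the transcript given the samples `x`. -/
noncomputable def productMixture [DecidableEq ι] [MeasurableSpace T] (μ : (ι → κ) → Measure T)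
    (w : ι → κ → ℝ) : Measure T :=
  ∑ x, (∏ i, ENNReal.ofReal (w i (x i))) • μ x

/-- The density of `productMixture μ w` when the densities of the laws `μ x` have the factors
`f i y`. -/
noncomputable def mixDensity (f : ι → κ → T → ℝ≥0) (w : ι → κ → ℝ) (t : T) : ℝ :=
  ∏ i, ∑ y, w i y * f i y t

theorem mixDensity_nonneg (f : ι → κ → T → ℝ≥0) {w : ι → κ → ℝ} (hw : ∀ i y, 0 ≤ w i y) (t : T) :
    0 ≤ mixDensity f w t :=
  Finset.prod_nonneg fun i _ =>
    Finset.sum_nonneg fun y _ => mul_nonneg (hw i y) (NNReal.coe_nonneg _)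

theorem ofReal_mixDensity [DecidableEq ι] (f : ι → κ → T → ℝ≥0) {w : ι → κ → ℝ}
    (hw : ∀ i y, 0 ≤ w i y) (t : T) :
    ENNReal.ofReal (mixDensity f w t) =
      ∑ x : ι → κ, (∏ i, ENNReal.ofReal (w i (x i))) * ((∏ i, f i (x i) t : ℝ≥0) : ℝ≥0∞) := by
  have h : ∀ i, ENNReal.ofReal (∑ y, w i y * f i y t) = ∑ y, ENNReal.ofReal (w i y) * f i y t :=
    fun i => by
      rw [ENNReal.ofReal_sum_of_nonneg fun y _ => mul_nonneg (hw i y) (NNReal.coe_nonneg _)]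
      simp only [ENNReal.ofReal_mul (hw i _), ENNReal.ofReal_coe_nnreal]
  rw [mixDensity, ENNReal.ofReal_prod_of_nonneg fun i _ =>
    Finset.sum_nonneg fun y _ => mul_nonneg (hw i y) (NNReal.coe_nonneg _)]
  simp only [h, Finset.prod_univ_sum, Fintype.piFinset_univ, Finset.prod_mul_distrib,
    ENNReal.ofNNReal_finsetProd]

variable [MeasurableSpace T] {μ : (ι → κ) → Measure T} {ν : Measure T} {f : ι → κ → T → ℝ≥0}
  {w : ι → κ → ℝ}

theorem HasProductDensity.measurable_mixDensity (h : HasProductDensity μ ν f) (w : ι → κ → ℝ) :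
    Measurable (mixDensity f w) :=
  Finset.measurable_fun_prod _ fun i _ => Finset.measurable_fun_sum _ fun y _ =>
    (h.measurable i y).coe_nnreal_real.const_mul _

theorem isProbabilityMeasure_productMixture [DecidableEq ι] (μ : (ι → κ) → Measure T)
    [∀ x, IsProbabilityMeasure (μ x)] (hw : ∀ i, w i ∈ stdSimplex ℝ κ) :
    IsProbabilityMeasure (productMixture μ w) := by
  have hsum : ∀ i, ∑ y, ENNReal.ofReal (w i y) = 1 := fun i => by
    rw [← ENNReal.ofReal_sum_of_nonneg fun y _ => (hw i).1 y, (hw i).2, ENNReal.ofReal_one]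
  have hprod := Finset.prod_univ_sum (fun _ : ι => (Finset.univ : Finset κ))
    fun i y => ENNReal.ofReal (w i y)
  simp only [hsum, Finset.prod_const_one, Fintype.piFinset_univ] at hprod
  constructor
  simp only [productMixture, Measure.finsetSum_apply, Measure.smul_apply, measure_univ, smul_eq_mul,
    mul_one]
  exact hprod.symm

theorem HasProductDensity.productMixture_eq_withDensity [DecidableEq ι]
    (h : HasProductDensity μ ν f) (hw : ∀ i y, 0 ≤ w i y) :
    productMixture μ w = ν.withDensity fun t => ENNReal.ofReal (mixDensity f w t) := by
  ext s hs
  rw [withDensity_apply _ hs, productMixture, Measure.finsetSum_apply]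
  simp only [ofReal_mixDensity f hw]
  rw [lintegral_finsetSum _ fun x _ => (h.measurable_prod x).const_mul _]
  refine Finset.sum_congr rfl fun x _ => ?_
  rw [lintegral_const_mul _ (h.measurable_prod x), Measure.smul_apply, smul_eq_mul,
    h.eq_withDensity, withDensity_apply _ hs]

theorem HasProductDensity.lintegral_mixDensity [∀ x, IsProbabilityMeasure (μ x)]
    (h : HasProductDensity μ ν f) (hw : ∀ i, w i ∈ stdSimplex ℝ κ) :
    ∫⁻ t, ENNReal.ofReal (mixDensity f w t) ∂ν = 1 := by
  classical
  have := isProbabilityMeasure_productMixture μ hw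
  rw [← setLIntegral_univ, ← withDensity_apply _ MeasurableSet.univ,
    ← h.productMixture_eq_withDensity fun i => (hw i).1, measure_univ]

theorem HasProductDensity.integrable_mixDensity [∀ x, IsProbabilityMeasure (μ x)]
    (h : HasProductDensity μ ν f) (hw : ∀ i, w i ∈ stdSimplex ℝ κ) :
    Integrable (mixDensity f w) ν := by
  refine ⟨(h.measurable_mixDensity w).aestronglyMeasurable, ?_⟩
  rw [hasFiniteIntegral_iff_ofReal (ae_of_all _ (mixDensity_nonneg f fun i => (hw i).1)),
    h.lintegral_mixDensity hw]
  exact ENNReal.one_lt_top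

theorem HasProductDensity.integral_mixDensity [∀ x, IsProbabilityMeasure (μ x)]
    (h : HasProductDensity μ ν f) (hw : ∀ i, w i ∈ stdSimplex ℝ κ) :
    ∫ t, mixDensity f w t ∂ν = 1 := by
  rw [integral_eq_lintegral_of_nonneg_ae (ae_of_all _ (mixDensity_nonneg f fun i => (hw i).1))
    (h.measurable_mixDensity w).aestronglyMeasurable, h.lintegral_mixDensity hw, ENNReal.toReal_one]

end Mixture

theorem Protocol.lawUnder_eq_productMixture {k n : ℕ} (A : Protocol k n) (p : Fin k → ℝ) :
    A.lawUnder p = productMixture A.law fun _ => p :=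
  rfl

theorem Protocol.IsLDP.ae_density_le {k n : ℕ} {A : Protocol k n} {α : ℝ} (hA : A.IsLDP α 0)
    {ν : Measure (Fin A.rounds → A.Msg)} [SigmaFinite ν]
    {f : Fin n → Fin k → (Fin A.rounds → A.Msg) → ℝ≥0} (hf : HasProductDensity A.law ν f) :
    ∀ᵐ t ∂ν, ∀ (x : Fin n → Fin k) (i : Fin n) (y : Fin k),
      ∏ j, f j (x j) t ≤ (Real.exp α).toNNReal * ∏ j, f j (Function.update x i y j) t := by
  simp only [ae_all_iff]
  intro x i y
  have hle := ae_le_of_forall_setLIntegral_le_of_sigmaFinite (μ := ν) (hf.measurable_prod x)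
    (g := fun t => ((Real.exp α).toNNReal : ℝ≥0∞) *
      ((∏ j, f j (Function.update x i y j) t : ℝ≥0) : ℝ≥0∞)) fun s hs _ => by
    rw [lintegral_const_mul _ (hf.measurable_prod _), ← withDensity_apply _ hs,
      ← withDensity_apply _ hs, ← hf.eq_withDensity, ← hf.eq_withDensity]
    simpa [ENNReal.ofReal] using hA x i y s hs
  filter_upwards [hle] with t ht
  exact_mod_cast ht

theorem sub_mul_sq_le_log_one_add {E d : ℝ} (hd : 0 < 1 + d) (hE : 1 ≤ E * (1 + d)) :
    d - E * d ^ 2 ≤ Real.log (1 + d) := by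
  have hinv : (1 + d)⁻¹ ≤ E := (inv_le_iff_one_le_mul₀ hd).2 hE
  calc d - E * d ^ 2 ≤ d - (1 + d)⁻¹ * d ^ 2 := by gcongr
    _ = 1 - (1 + d)⁻¹ := by field_simp; ring
    _ ≤ Real.log (1 + d) := Real.one_sub_inv_le_log_of_pos hd

theorem one_sub_sqrt_prod_sq_le {ι : Type*} [Fintype ι] {E : ℝ} {d : ι → ℝ}
    (hd : ∀ i, 0 < 1 + d i) (hE : ∀ i, 1 ≤ E * (1 + d i)) :
    (1 - √(∏ i, (1 + d i))) ^ 2 ≤ ∏ i, (1 + d i) - 1 - ∑ i, d i + E * ∑ i, d i ^ 2 := by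
  set L := ∏ i, (1 + d i) with hL
  have hLpos : 0 < L := Finset.prod_pos fun i _ => hd i
  have hlog : ∑ i, d i - E * ∑ i, d i ^ 2 ≤ 2 * Real.log √L := by
    rw [Real.log_sqrt hLpos.le, hL, Real.log_prod fun i _ => (hd i).ne',
      mul_div_cancel₀ _ two_ne_zero, Finset.mul_sum, ← Finset.sum_sub_distrib]
    exact Finset.sum_le_sum fun i _ => sub_mul_sq_le_log_one_add (hd i) (hE i)
  have hsqrt := Real.log_le_sub_one_of_pos (Real.sqrt_pos.2 hLpos)
  linear_combination hlog + 2 * hsqrt + Real.sq_sqrt hLpos.le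

/-- When the products are probability densities, everything on the right but the last term
integrates to `0`, so the Hellinger distance is of second order in `D`. -/
theorem sqrt_prod_sub_sqrt_prod_sq_le {ι : Type*} [Fintype ι] [DecidableEq ι] {a b : ι → ℝ}
    {D E : ℝ} (ha : ∀ i, 0 < a i) (hE : 0 ≤ E) (hab : ∀ i, a i ≤ E * b i)
    (hD : ∀ i, |b i - a i| ≤ D * a i) :
    (√(∏ i, a i) - √(∏ i, b i)) ^ 2 ≤
      ∏ i, b i - ∏ i, a i - ∑ i, (∏ j, Function.update a i (b i) j - ∏ j, a j)
        + E * (Fintype.card ι * D ^ 2) * ∏ i, a i := by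
  set P := ∏ i, a i with hP
  have hPpos : 0 < P := Finset.prod_pos fun i _ => ha i
  obtain ⟨d, hd⟩ : ∃ d : ι → ℝ, ∀ i, b i = a i * (1 + d i) :=
    ⟨fun i => b i / a i - 1, fun i => by have := (ha i).ne'; field_simp; ring⟩
  have hratio : ∀ i, 1 ≤ E * (1 + d i) := fun i => by
    have := hab i
    rw [hd, mul_left_comm] at this
    exact le_of_mul_le_mul_left (by simpa using this) (ha i)
  have hdpos : ∀ i, 0 < 1 + d i := fun i => pos_of_mul_pos_right (one_pos.trans_le (hratio i)) hE
  have hQ : ∏ i, b i = P * ∏ i, (1 + d i) := by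
    simp only [hd, Finset.prod_mul_distrib, ← hP]
  have hM : ∀ i, ∏ j, Function.update a i (b i) j - P = P * d i := fun i => by
    rw [Finset.prod_update_of_mem (Finset.mem_univ i), hP,
      ← Finset.mul_prod_erase _ _ (Finset.mem_univ i), ← Finset.erase_eq, hd]
    ring
  have hdD : ∑ i, d i ^ 2 ≤ Fintype.card ι * D ^ 2 := by
    have : ∀ i, d i ^ 2 ≤ D ^ 2 := fun i => by
      have := hD i
      rw [hd, mul_one_add, add_sub_cancel_left, abs_mul, abs_of_pos (ha i), mul_comm] at this
      exact sq_le_sq' (abs_le.1 (le_of_mul_le_mul_right this (ha i))).1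
        (abs_le.1 (le_of_mul_le_mul_right this (ha i))).2
    simpa using Finset.sum_le_sum fun i (_ : i ∈ Finset.univ) => this i
  calc (√P - √(∏ i, b i)) ^ 2 = P * (1 - √(∏ i, (1 + d i))) ^ 2 := by
        rw [hQ, Real.sqrt_mul hPpos.le]
        linear_combination (1 - √(∏ i, (1 + d i))) ^ 2 * Real.sq_sqrt hPpos.le
    _ ≤ P * (∏ i, (1 + d i) - 1 - ∑ i, d i + E * (Fintype.card ι * D ^ 2)) := by
        gcongr
        exact (one_sub_sqrt_prod_sq_le hdpos hratio).trans (by gcongr)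
    _ = _ := by
        rw [Finset.sum_congr rfl fun i _ => hM i, ← Finset.mul_sum, hQ]
        ring

theorem one_sub_mul_sub_sq_div_le_min {P Q l : ℝ} (hP : 0 ≤ P) (hQ : 0 ≤ Q) (hl : 0 < l) :
    (1 - l) * P - (√P - √Q) ^ 2 / l ≤ min P Q := by
  refine le_min (by nlinarith [div_nonneg (sq_nonneg (√P - √Q)) hl.le]) ?_
  rw [sub_le_iff_le_add, ← sub_le_iff_le_add', le_div_iff₀ hl]
  linear_combination sq_nonneg (l * √P - (√P - √Q)) + mul_nonneg hl.le (sq_nonneg (√P - √Q))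
    - l * (1 - l) * Real.sq_sqrt hP + l * Real.sq_sqrt hQ

theorem integrable_sqrt_sub_sqrt_sq {T : Type*} [MeasurableSpace T] {ν : Measure T} {P Q : T → ℝ}
    (hP : Integrable P ν) (hQ : Integrable Q ν) (hP0 : 0 ≤ P) (hQ0 : 0 ≤ Q) :
    Integrable (fun t => (√(P t) - √(Q t)) ^ 2) ν := by
  refine (hP.add hQ).mono' ?_ (ae_of_all _ fun t => ?_)
  · exact ((Real.continuous_sqrt.comp_aestronglyMeasurable hP.1).sub
      (Real.continuous_sqrt.comp_aestronglyMeasurable hQ.1)).pow 2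
  · rw [Real.norm_of_nonneg (sq_nonneg _), Pi.add_apply]
    nlinarith [Real.sq_sqrt (hP0 t), Real.sq_sqrt (hQ0 t), Real.sqrt_nonneg (P t),
      Real.sqrt_nonneg (Q t), mul_nonneg (Real.sqrt_nonneg (P t)) (Real.sqrt_nonneg (Q t))]

theorem one_sub_sub_div_le_integral_min {T : Type*} [MeasurableSpace T] {ν : Measure T}
    {P Q : T → ℝ} (hP : Integrable P ν) (hQ : Integrable Q ν) (hP0 : 0 ≤ P) (hQ0 : 0 ≤ Q)
    (hP1 : ∫ t, P t ∂ν = 1) {l : ℝ} (hl : 0 < l) :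
    1 - l - (∫ t, (√(P t) - √(Q t)) ^ 2 ∂ν) / l ≤ ∫ t, min (P t) (Q t) ∂ν := by
  have hH := (integrable_sqrt_sub_sqrt_sq hP hQ hP0 hQ0).div_const l
  calc 1 - l - (∫ t, (√(P t) - √(Q t)) ^ 2 ∂ν) / l
      = ∫ t, ((1 - l) * P t - (√(P t) - √(Q t)) ^ 2 / l) ∂ν := by
        rw [integral_sub (hP.const_mul _) hH, integral_const_mul, integral_div, hP1, mul_one]
    _ ≤ _ := integral_mono ((hP.const_mul _).sub hH) (hP.inf hQ) fun t =>
        one_sub_mul_sub_sq_div_le_min (hP0 t) (hQ0 t) hl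

theorem forall_eq_zero_or_forall_pos {ι κ : Type*} [Fintype ι] [DecidableEq ι] {f : ι → κ → ℝ≥0}
    {E : ℝ≥0} (h : ∀ (x : ι → κ) (i : ι) (y : κ),
      ∏ j, f j (x j) ≤ E * ∏ j, f j (Function.update x i y j)) :
    (∃ i, ∀ y, f i y = 0) ∨ ∀ i y, 0 < f i y := by
  by_contra! hneg
  obtain ⟨hne, i, y, hiy⟩ := hneg
  choose x hx using hne
  have hpos : 0 < ∏ j, f j (x j) := Finset.prod_pos fun j _ => pos_iff_ne_zero.2 (hx j)
  have hzero : ∏ j, f j (Function.update x i y j) = 0 :=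
    Finset.prod_eq_zero (Finset.mem_univ i) (by simpa using hiy)
  have hle := h x i y
  rw [hzero, mul_zero] at hle
  exact hle.not_gt hpos

theorem apply_le_mul_apply_of_prod_le {ι κ : Type*} [Fintype ι] [DecidableEq ι] {f : ι → κ → ℝ≥0}
    {E : ℝ≥0} (hpos : ∀ i y, 0 < f i y) (h : ∀ (x : ι → κ) (i : ι) (y : κ),
      ∏ j, f j (x j) ≤ E * ∏ j, f j (Function.update x i y j)) (i : ι) (y z : κ) :
    f i y ≤ E * f i z := by
  have hle := h (fun _ => y) i z
  rw [← Finset.mul_prod_erase _ _ (Finset.mem_univ i),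
    ← Finset.mul_prod_erase _ (fun j => f j (Function.update (fun _ => y) i z j))
      (Finset.mem_univ i),
    Function.update_self, ← mul_assoc] at hle
  have herase : ∏ j ∈ Finset.univ.erase i, f j (Function.update (fun _ => y) i z j) =
      ∏ j ∈ Finset.univ.erase i, f j y :=
    Finset.prod_congr rfl fun j hj => by rw [Function.update_of_ne (Finset.ne_of_mem_erase hj)]
  rw [herase] at hle
  exact le_of_mul_le_mul_right hle (Finset.prod_pos fun j _ => hpos j _)

theorem le_mul_sum_of_forall_le {κ : Type*} [Fintype κ] {g w : κ → ℝ} {c E : ℝ}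
    (hg : ∀ y, c ≤ E * g y) (hw : w ∈ stdSimplex ℝ κ) : c ≤ E * ∑ y, w y * g y := by
  calc c = ∑ y, w y * c := by rw [← Finset.sum_mul, hw.2, one_mul]
    _ ≤ ∑ y, w y * (E * g y) :=
      Finset.sum_le_sum fun y _ => mul_le_mul_of_nonneg_left (hg y) (hw.1 y)
    _ = E * ∑ y, w y * g y := by
      rw [Finset.mul_sum]
      exact Finset.sum_congr rfl fun y _ => mul_left_comm _ _ _

theorem sum_mul_le_mul_sum {κ : Type*} [Fintype κ] {g : κ → ℝ} {E : ℝ}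
    (hg : ∀ y z, g y ≤ E * g z) {v w : κ → ℝ} (hv : v ∈ stdSimplex ℝ κ)
    (hw : w ∈ stdSimplex ℝ κ) : ∑ y, v y * g y ≤ E * ∑ y, w y * g y := by
  calc ∑ y, v y * g y ≤ ∑ y, v y * (E * ∑ z, w z * g z) :=
        Finset.sum_le_sum fun y _ =>
          mul_le_mul_of_nonneg_left (le_mul_sum_of_forall_le (hg y) hw) (hv.1 y)
    _ = E * ∑ z, w z * g z := by rw [← Finset.sum_mul, hv.2, one_mul]

theorem abs_sub_le_mul_sum {κ : Type*} [Fintype κ] {g : κ → ℝ} {E : ℝ} (hE : 1 ≤ E)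
    (hg : ∀ y z, g y ≤ E * g z) {w : κ → ℝ} (hw : w ∈ stdSimplex ℝ κ) (a b : κ) :
    |g a - g b| ≤ (E - 1) * ∑ y, w y * g y := by
  obtain ⟨z, -, hz⟩ := Finset.exists_min_image Finset.univ g ⟨a, Finset.mem_univ a⟩
  have hmin : g z ≤ ∑ y, w y * g y := by
    simpa using le_mul_sum_of_forall_le (E := 1) (c := g z) (by simpa using hz) hw
  refine le_trans ?_ (mul_le_mul_of_nonneg_left hmin (by linarith))
  rw [abs_le]
  constructor <;>
    linarith [hg a z, hg b z, hz a (Finset.mem_univ a), hz b (Finset.mem_univ b)]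

section TwoPoint

variable {ι κ T : Type*} [Fintype ι] [DecidableEq ι] [Fintype κ]

theorem mixDensity_update_const (f : ι → κ → T → ℝ≥0) (p q : κ → ℝ) (i : ι) (t : T) :
    mixDensity f (Function.update (fun _ => p) i q) t =
      ∏ j, Function.update (fun j => ∑ y, p y * (f j y t : ℝ)) i (∑ y, q y * (f i y t : ℝ)) j := by
  refine Finset.prod_congr rfl fun j _ => ?_
  rcases eq_or_ne j i with rfl | hj
  · simp
  · simp [hj]

variable [DecidableEq κ] {f : ι → κ → T → ℝ≥0} {E : ℝ≥0} {p q : κ → ℝ} {a b : κ} {c : ℝ}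

theorem sqrt_mixDensity_sub_sqrt_mixDensity_sq_le (hE : 1 ≤ E) {t : T}
    (hf : ∀ (x : ι → κ) (i : ι) (y : κ),
      ∏ j, f j (x j) t ≤ E * ∏ j, f j (Function.update x i y j) t)
    (hp : p ∈ stdSimplex ℝ κ) (hq : q ∈ stdSimplex ℝ κ)
    (hqp : q - p = c • (Pi.single a 1 - Pi.single b 1)) :
    (√(mixDensity f (fun _ => p) t) - √(mixDensity f (fun _ => q) t)) ^ 2 ≤
      mixDensity f (fun _ => q) t - mixDensity f (fun _ => p) t
        - ∑ i, (mixDensity f (Function.update (fun _ => p) i q) t - mixDensity f (fun _ => p) t)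
        + E * (Fintype.card ι * (|c| * (E - 1)) ^ 2) * mixDensity f (fun _ => p) t := by
  rcases forall_eq_zero_or_forall_pos (f := fun i y => f i y t) hf with ⟨i, hi⟩ | hpos
  · have hzero : ∀ w : ι → κ → ℝ, mixDensity f w t = 0 := fun w =>
      Finset.prod_eq_zero (Finset.mem_univ i) (by simp [hi])
    simp [hzero]
  have hratio : ∀ i y z, (f i y t : ℝ) ≤ E * f i z t := fun i y z => by
    exact_mod_cast apply_le_mul_apply_of_prod_le (f := fun i y => f i y t) hpos hf i y z
  simp only [mixDensity_update_const]
  refine sqrt_prod_sub_sqrt_prod_sq_le (fun i => ?_) E.coe_nonneg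
    (fun i => sum_mul_le_mul_sum (hratio i) hp hq) fun i => ?_
  · have hfa : (0 : ℝ) < f i a t := by exact_mod_cast hpos i a
    exact pos_of_mul_pos_right
      (hfa.trans_le (le_mul_sum_of_forall_le (hratio i a) hp)) E.coe_nonneg
  · have hdiff : q ⬝ᵥ (fun y => (f i y t : ℝ)) - p ⬝ᵥ (fun y => (f i y t : ℝ)) =
        c * (f i a t - f i b t) := by
      have hdot := congrArg (· ⬝ᵥ fun y => (f i y t : ℝ)) hqp
      simpa only [sub_dotProduct, smul_dotProduct, single_one_dotProduct,
        smul_eq_mul] using hdot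
    simp only [dotProduct] at hdiff
    rw [hdiff, abs_mul, mul_assoc]
    exact mul_le_mul_of_nonneg_left
      (abs_sub_le_mul_sum (by exact_mod_cast hE) (hratio i) hp a b) (abs_nonneg c)

variable [MeasurableSpace T] {μ : (ι → κ) → Measure T} [∀ x, IsProbabilityMeasure (μ x)]
  {ν : Measure T}

theorem HasProductDensity.integral_sqrt_sub_sqrt_sq_le (h : HasProductDensity μ ν f) (hE : 1 ≤ E)
    (hf : ∀ᵐ t ∂ν, ∀ (x : ι → κ) (i : ι) (y : κ),
      ∏ j, f j (x j) t ≤ E * ∏ j, f j (Function.update x i y j) t)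
    (hp : p ∈ stdSimplex ℝ κ) (hq : q ∈ stdSimplex ℝ κ)
    (hqp : q - p = c • (Pi.single a 1 - Pi.single b 1)) :
    ∫ t, (√(mixDensity f (fun _ => p) t) - √(mixDensity f (fun _ => q) t)) ^ 2 ∂ν ≤
      E * (Fintype.card ι * (|c| * (E - 1)) ^ 2) := by
  have hupdate : ∀ i j, Function.update (fun _ : ι => p) i q j ∈ stdSimplex ℝ κ := fun i j => by
    rcases eq_or_ne j i with rfl | hj
    · simpa using hq
    · simpa [hj] using hp
  have hP := h.integrable_mixDensity (w := fun _ => p) fun _ => hp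
  have hQ := h.integrable_mixDensity (w := fun _ => q) fun _ => hq
  have hM := fun i => h.integrable_mixDensity (hupdate i)
  have hMP : ∀ i, Integrable (fun t => mixDensity f (Function.update (fun _ => p) i q) t
      - mixDensity f (fun _ => p) t) ν := fun i => (hM i).sub hP
  have hsum := integrable_finsetSum Finset.univ fun i _ => hMP i
  have hnonneg : ∀ {w : κ → ℝ}, w ∈ stdSimplex ℝ κ → 0 ≤ mixDensity f fun _ : ι => w :=
    fun hw => mixDensity_nonneg f fun _ => hw.1
  refine (integral_mono_ae (integrable_sqrt_sub_sqrt_sq hP hQ (hnonneg hp) (hnonneg hq))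
    (((hQ.sub hP).sub hsum).add (hP.const_mul _)) (by
      filter_upwards [hf] with t ht
      exact sqrt_mixDensity_sub_sqrt_mixDensity_sq_le hE ht hp hq hqp)).trans_eq ?_
  rw [integral_add' ((hQ.sub hP).sub hsum) (hP.const_mul _), integral_sub' (hQ.sub hP) hsum,
    integral_sub' hQ hP, integral_finsetSum _ fun i _ => hMP i, integral_const_mul]
  simp [integral_sub (hM _) hP, h.integral_mixDensity (hupdate _),
    h.integral_mixDensity (w := fun _ => p) fun _ => hp,
    h.integral_mixDensity (w := fun _ => q) fun _ => hq]

theorem HasProductDensity.three_fourths_le_integral_min (h : HasProductDensity μ ν f) (hE : 1 ≤ E)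
    (hf : ∀ᵐ t ∂ν, ∀ (x : ι → κ) (i : ι) (y : κ),
      ∏ j, f j (x j) t ≤ E * ∏ j, f j (Function.update x i y j) t)
    (hp : p ∈ stdSimplex ℝ κ) (hq : q ∈ stdSimplex ℝ κ)
    (hqp : q - p = c • (Pi.single a 1 - Pi.single b 1))
    (hc : 64 * (E * (Fintype.card ι * (|c| * (E - 1)) ^ 2)) ≤ 1) :
    3 / 4 ≤ ∫ t, min (mixDensity f (fun _ => p) t) (mixDensity f (fun _ => q) t) ∂ν := by
  have hH := h.integral_sqrt_sub_sqrt_sq_le hE hf hp hq hqp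
  have hmin := one_sub_sub_div_le_integral_min
    (h.integrable_mixDensity (w := fun _ => p) fun _ => hp)
    (h.integrable_mixDensity (w := fun _ => q) fun _ => hq)
    (mixDensity_nonneg f fun _ => hp.1) (mixDensity_nonneg f fun _ => hq.1)
    (h.integral_mixDensity fun _ => hp) (l := 1 / 8) (by norm_num)
  linarith

end TwoPoint

theorem ofReal_mul_le_lintegral_add_lintegral {T : Type*} [MeasurableSpace T] {ν : Measure T}
    {P Q : T → ℝ} (hP : Integrable P ν) (hQ : Integrable Q ν) (hPm : Measurable P)
    (hQm : Measurable Q) (hP0 : 0 ≤ P) (hQ0 : 0 ≤ Q) {s : ℝ}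
    (hs : s ≤ ∫ t, min (P t) (Q t) ∂ν) {g h : T → ℝ≥0∞} (hg : Measurable g) (hh : Measurable h)
    {δ : ℝ≥0∞} (hgh : ∀ t, δ ≤ g t + h t) :
    ENNReal.ofReal s * δ ≤
      ∫⁻ t, g t ∂(ν.withDensity fun t => ENNReal.ofReal (P t))
        + ∫⁻ t, h t ∂(ν.withDensity fun t => ENNReal.ofReal (Q t)) := by
  have hint : Integrable (fun t => min (P t) (Q t)) ν := hP.inf hQ
  have hmin := (hPm.min hQm).ennreal_ofReal
  rw [lintegral_withDensity_eq_lintegral_mul _ hPm.ennreal_ofReal hg,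
    lintegral_withDensity_eq_lintegral_mul _ hQm.ennreal_ofReal hh,
    ← lintegral_add_left (hPm.ennreal_ofReal.mul hg)]
  calc ENNReal.ofReal s * δ ≤ ENNReal.ofReal (∫ t, min (P t) (Q t) ∂ν) * δ := by gcongr
    _ = ∫⁻ t, ENNReal.ofReal (min (P t) (Q t)) * δ ∂ν := by
      rw [lintegral_mul_const _ hmin, ofReal_integral_eq_lintegral_ofReal hint
        (ae_of_all _ fun t => le_min (hP0 t) (hQ0 t))]
    _ ≤ _ := lintegral_mono fun t => by
      refine (mul_le_mul_right (hgh t) _).trans ?_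
      rw [mul_add]
      exact add_le_add (mul_le_mul_left (ENNReal.ofReal_le_ofReal (min_le_left _ _)) _)
        (mul_le_mul_left (ENNReal.ofReal_le_ofReal (min_le_right _ _)) _)

theorem Protocol.IsLDP.three_fourths_mul_le_lintegral_add_lintegral {k n : ℕ} {A : Protocol k n}
    {α : ℝ} (hA : A.IsLDP α 0) (hα : 0 ≤ α) {p q : Fin k → ℝ} (hp : p ∈ stdSimplex ℝ (Fin k))
    (hq : q ∈ stdSimplex ℝ (Fin k)) {a b : Fin k} {c : ℝ}
    (hqp : q - p = c • (Pi.single a 1 - Pi.single b 1))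
    (hc : 64 * (Real.exp α * (n * (|c| * (Real.exp α - 1)) ^ 2)) ≤ 1)
    {g h : (Fin A.rounds → A.Msg) → ℝ≥0∞} (hg : Measurable g) (hh : Measurable h) {δ : ℝ≥0∞}
    (hgh : ∀ t, δ ≤ g t + h t) :
    ENNReal.ofReal (3 / 4) * δ ≤ ∫⁻ t, g t ∂(A.lawUnder p) + ∫⁻ t, h t ∂(A.lawUnder q) := by
  obtain ⟨ν, hν, f, hf : HasProductDensity A.law ν f⟩ := A.exists_hasProductDensity A.rounds
  have hE : ((Real.exp α).toNNReal : ℝ) = Real.exp α := Real.coe_toNNReal _ (Real.exp_pos α).le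
  rw [A.lawUnder_eq_productMixture, A.lawUnder_eq_productMixture,
    hf.productMixture_eq_withDensity fun _ => hp.1, hf.productMixture_eq_withDensity fun _ => hq.1]
  refine ofReal_mul_le_lintegral_add_lintegral (hf.integrable_mixDensity fun _ => hp)
    (hf.integrable_mixDensity fun _ => hq) (hf.measurable_mixDensity _) (hf.measurable_mixDensity _)
    (mixDensity_nonneg f fun _ => hp.1) (mixDensity_nonneg f fun _ => hq.1) ?_ hg hh hgh
  exact hf.three_fourths_le_integral_min (Real.one_le_toNNReal.2 (Real.one_le_exp hα))
    (hA.ae_density_le hf) hp hq hqp (by simpa only [hE, Fintype.card_fin] using hc)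

section Hypercube

variable {σ : Type*} [DecidableEq σ]

/-- The neighbour of the vertex `v` of the hypercube `σ → Bool` across the coordinate `j`. -/
def flipAt (j : σ) (v : σ → Bool) : σ → Bool := Function.update v j (!v j)

theorem flipAt_involutive (j : σ) : Function.Involutive (flipAt j) := fun v => by
  simp [flipAt]

variable [Fintype σ]

theorem card_mul_le_two_mul_of_le_add_flipAt {R : σ → (σ → Bool) → ℝ≥0∞} {δ W : ℝ≥0∞}
    (hpair : ∀ j v, δ ≤ R j v + R j (flipAt j v)) (hsum : ∀ v, ∑ j, R j v ≤ W) :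
    Fintype.card σ * δ ≤ 2 * W := by
  have hj : ∀ j, ∑ _v : σ → Bool, δ ≤ 2 * ∑ v, R j v := fun j =>
    calc ∑ _v : σ → Bool, δ ≤ ∑ v, (R j v + R j (flipAt j v)) :=
          Finset.sum_le_sum fun v _ => hpair j v
      _ = 2 * ∑ v, R j v := by
          rw [Finset.sum_add_distrib, two_mul, ← Equiv.sum_comp (flipAt_involutive j).toPerm (R j)]
          rfl
  have hall : Fintype.card (σ → Bool) * (Fintype.card σ * δ) ≤
      Fintype.card (σ → Bool) * (2 * W) :=
    calc Fintype.card (σ → Bool) * (Fintype.card σ * δ) = ∑ _j : σ, ∑ _v : σ → Bool, δ := by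
          simp only [Finset.sum_const, Finset.card_univ, nsmul_eq_mul]
          ring
      _ ≤ ∑ j, 2 * ∑ v, R j v := Finset.sum_le_sum fun j _ => hj j
      _ = 2 * ∑ v, ∑ j, R j v := by rw [← Finset.mul_sum, Finset.sum_comm]
      _ ≤ 2 * ∑ _v : σ → Bool, W := by gcongr with v; exact hsum v
      _ = Fintype.card (σ → Bool) * (2 * W) := by
          simp only [Finset.sum_const, Finset.card_univ, nsmul_eq_mul]
          ring
  exact (ENNReal.mul_le_mul_iff_right (by simp) (by simp)).1 hall

end Hypercube

section CubePoint

variable {σ κ : Type*} [Fintype σ]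

/-- The probability weights on `σ × Bool` attached to the vertex `v` of the hypercube in Assouad's
method: each pair `{(j, false), (j, true)}` has mass `1 / card σ`, and `v j` says which of its two
points is the heavier, by the relative amount `γ`. -/
noncomputable def cubeWeight (γ : ℝ) (v : σ → Bool) (z : σ × Bool) : ℝ :=
  (1 + γ * if v z.1 = z.2 then 1 else -1) / (2 * Fintype.card σ)

/-- The distribution on `κ` with the weights `cubeWeight γ v` on the range of `e`. -/
noncomputable def cubePoint (γ : ℝ) (e : σ × Bool ↪ κ) (v : σ → Bool) : κ → ℝ :=
  Function.extend e (cubeWeight γ v) 0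

/-- The part of the `ℓ₁` distance between `y` and `cubePoint γ e v` that lies over the pair `j`. -/
noncomputable def pairLoss (γ : ℝ) (e : σ × Bool ↪ κ) (v : σ → Bool) (j : σ) (y : κ → ℝ) : ℝ :=
  ∑ b, |y (e (j, b)) - cubePoint γ e v (e (j, b))|

theorem cubeWeight_nonneg {γ : ℝ} (hγ : |γ| ≤ 1) (v : σ → Bool) (z : σ × Bool) :
    0 ≤ cubeWeight γ v z := by
  obtain ⟨hneg, hpos⟩ := abs_le.1 hγ
  refine div_nonneg ?_ (by positivity)
  split_ifs <;> linarith

theorem sum_cubeWeight [Nonempty σ] (γ : ℝ) (v : σ → Bool) : ∑ z, cubeWeight γ v z = 1 := by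
  have hpair : ∀ j : σ, ∑ b, cubeWeight γ v (j, b) = 1 / Fintype.card σ := fun j => by
    rw [Fintype.sum_bool]
    cases hv : v j <;> simp [cubeWeight, hv] <;> ring
  rw [Fintype.sum_prod_type, Finset.sum_congr rfl fun j _ => hpair j]
  simp

theorem cubePoint_apply (γ : ℝ) (e : σ × Bool ↪ κ) (v : σ → Bool) (z : σ × Bool) :
    cubePoint γ e v (e z) = cubeWeight γ v z :=
  e.injective.extend_apply _ _ z

theorem cubePoint_apply_of_notMem_range (γ : ℝ) (e : σ × Bool ↪ κ) (v : σ → Bool) {x : κ}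
    (hx : ¬∃ z, e z = x) : cubePoint γ e v x = 0 :=
  Function.extend_apply' _ _ x hx

theorem pairLoss_nonneg (γ : ℝ) (e : σ × Bool ↪ κ) (v : σ → Bool) (j : σ) (y : κ → ℝ) :
    0 ≤ pairLoss γ e v j y :=
  Finset.sum_nonneg fun _ _ => abs_nonneg _

theorem measurable_pairLoss (γ : ℝ) (e : σ × Bool ↪ κ) (v : σ → Bool) (j : σ) :
    Measurable (pairLoss γ e v j) :=
  Finset.measurable_fun_sum _ fun _ _ => ((measurable_pi_apply _).sub_const _).abs

theorem cubePoint_mem_stdSimplex [Fintype κ] [Nonempty σ] {γ : ℝ} (hγ : |γ| ≤ 1) (e : σ × Bool ↪ κ)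
    (v : σ → Bool) : cubePoint γ e v ∈ stdSimplex ℝ κ := by
  refine ⟨fun x => ?_, ?_⟩
  · by_cases hx : ∃ z, e z = x
    · obtain ⟨z, rfl⟩ := hx
      exact (cubeWeight_nonneg hγ v z).trans_eq (cubePoint_apply γ e v z).symm
    · exact (cubePoint_apply_of_notMem_range γ e v hx).ge
  · rw [← sum_cubeWeight γ v]
    exact (Fintype.sum_of_injective e e.injective _ _
      (fun x hx => cubePoint_apply_of_notMem_range γ e v hx)
      fun z => (cubePoint_apply γ e v z).symm).symm

theorem sum_pairLoss_le [Fintype κ] (γ : ℝ) (e : σ × Bool ↪ κ) (v : σ → Bool) (y : κ → ℝ) :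
    ∑ j, pairLoss γ e v j y ≤ ∑ x, |y x - cubePoint γ e v x| := by
  simp only [pairLoss]
  rw [← Fintype.sum_prod_type' fun j b => |y (e (j, b)) - cubePoint γ e v (e (j, b))|,
    ← Finset.sum_map Finset.univ e fun x => |y x - cubePoint γ e v x|]
  exact Finset.sum_le_sum_of_subset_of_nonneg (Finset.subset_univ _) fun _ _ _ => abs_nonneg _

variable [DecidableEq σ]

theorem cubeWeight_flipAt_sub (γ : ℝ) (v : σ → Bool) (j i : σ) (b : Bool) :
    cubeWeight γ (flipAt j v) (i, b) - cubeWeight γ v (i, b) =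
      γ / Fintype.card σ * ((if (i, b) = (j, !v j) then 1 else 0)
        - if (i, b) = (j, v j) then 1 else 0) := by
  rcases eq_or_ne i j with rfl | hij
  · cases hv : v i <;> cases b <;> simp [cubeWeight, flipAt, hv] <;> ring
  · simp [cubeWeight, flipAt, hij]

theorem cubePoint_flipAt_sub [DecidableEq κ] (γ : ℝ) (e : σ × Bool ↪ κ) (v : σ → Bool) (j : σ) :
    cubePoint γ e (flipAt j v) - cubePoint γ e v =
      (γ / Fintype.card σ) • (Pi.single (e (j, !v j)) 1 - Pi.single (e (j, v j)) 1) := by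
  ext x
  by_cases hx : ∃ z, e z = x
  · obtain ⟨⟨i, b⟩, rfl⟩ := hx
    simp only [Pi.sub_apply, Pi.smul_apply, smul_eq_mul, cubePoint_apply, cubeWeight_flipAt_sub,
      Pi.single_apply, e.injective.eq_iff]
  · have hne : ∀ z, x ≠ e z := fun z hz => hx ⟨z, hz.symm⟩
    simp [cubePoint_apply_of_notMem_range γ e _ hx, hne]

theorem le_pairLoss_add_pairLoss_flipAt {γ : ℝ} (hγ : 0 ≤ γ) (e : σ × Bool ↪ κ) (v : σ → Bool)
    (j : σ) (y : κ → ℝ) :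
    2 * γ / Fintype.card σ ≤ pairLoss γ e v j y + pairLoss γ e (flipAt j v) j y := by
  have hb : ∀ b, γ / Fintype.card σ ≤ |y (e (j, b)) - cubePoint γ e v (e (j, b))| +
      |y (e (j, b)) - cubePoint γ e (flipAt j v) (e (j, b))| := fun b => by
    have hdist : |cubeWeight γ (flipAt j v) (j, b) - cubeWeight γ v (j, b)| =
        γ / Fintype.card σ := by
      rw [cubeWeight_flipAt_sub]
      cases hv : v j <;> cases b <;> simp [abs_of_nonneg hγ, abs_div]
    rw [← hdist, cubePoint_apply, cubePoint_apply, abs_sub_comm (y _) (cubeWeight _ (flipAt j v) _),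
      add_comm]
    exact abs_sub_le _ _ _
  have hsum := add_le_add (hb true) (hb false)
  simp only [pairLoss, Fintype.sum_bool]
  linear_combination hsum

end CubePoint

theorem Protocol.sum_lintegral_pairLoss_le_worstRisk {k n : ℕ} (A : Protocol k n) {σ : Type*}
    [Fintype σ] [Nonempty σ] {γ : ℝ} (hγ : |γ| ≤ 1) (e : σ × Bool ↪ Fin k) (v : σ → Bool) :
    ∑ j, ∫⁻ t, ENNReal.ofReal (pairLoss γ e v j (A.est t)) ∂(A.lawUnder (cubePoint γ e v)) ≤
      A.worstRisk := by
  refine le_trans ?_ (le_iSup₂ (f := fun p (_ : p ∈ stdSimplex ℝ (Fin k)) => A.risk p)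
    (cubePoint γ e v) (cubePoint_mem_stdSimplex hγ e v))
  have hmeas : ∀ j, Measurable fun t => ENNReal.ofReal (pairLoss γ e v j (A.est t)) := fun j =>
    ((measurable_pairLoss γ e v j).comp A.measurable_est).ennreal_ofReal
  rw [← lintegral_finsetSum _ fun j _ => hmeas j]
  refine lintegral_mono fun t => ?_
  rw [← ENNReal.ofReal_sum_of_nonneg fun j _ => pairLoss_nonneg ..]
  exact ENNReal.ofReal_le_ofReal (sum_pairLoss_le γ e v _)

theorem Protocol.IsLDP.le_worstRisk {k n : ℕ} {A : Protocol k n} {α : ℝ} (hA : A.IsLDP α 0)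
    (hα : 0 ≤ α) {σ : Type*} [Fintype σ] [Nonempty σ] (e : σ × Bool ↪ Fin k) {γ : ℝ}
    (hγ0 : 0 ≤ γ) (hγ1 : γ ≤ 1)
    (hγ : 64 * (Real.exp α * (n * (γ / Fintype.card σ * (Real.exp α - 1)) ^ 2)) ≤ 1) :
    ENNReal.ofReal (3 / 4 * γ) ≤ A.worstRisk := by
  classical
  have hγ' : |γ| ≤ 1 := by rwa [abs_of_nonneg hγ0]
  have hmeas : ∀ j v, Measurable fun t => ENNReal.ofReal (pairLoss γ e v j (A.est t)) := fun j v =>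
    ((measurable_pairLoss γ e v j).comp A.measurable_est).ennreal_ofReal
  have hassouad := card_mul_le_two_mul_of_le_add_flipAt
    (R := fun j v =>
      ∫⁻ t, ENNReal.ofReal (pairLoss γ e v j (A.est t)) ∂(A.lawUnder (cubePoint γ e v)))
    (fun j v => hA.three_fourths_mul_le_lintegral_add_lintegral hα
      (cubePoint_mem_stdSimplex hγ' e v) (cubePoint_mem_stdSimplex hγ' e _)
      (cubePoint_flipAt_sub γ e v j) (by rwa [abs_of_nonneg (by positivity)])
      (hmeas j v) (hmeas j _) fun t => by
        rw [← ENNReal.ofReal_add (pairLoss_nonneg ..) (pairLoss_nonneg ..)]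
        exact ENNReal.ofReal_le_ofReal (le_pairLoss_add_pairLoss_flipAt hγ0 e v j _))
    fun v => A.sum_lintegral_pairLoss_le_worstRisk hγ' e v
  refine (ENNReal.mul_le_mul_iff_right two_ne_zero ENNReal.ofNat_ne_top).1 (hassouad.trans_eq' ?_)
  rw [← ENNReal.ofReal_mul (by norm_num), ← ENNReal.ofReal_natCast (Fintype.card σ),
    ← ENNReal.ofReal_mul (by positivity), ← ENNReal.ofReal_ofNat, ← ENNReal.ofReal_mul zero_le_two]
  congr 1
  field_simp

section Pi

variable {ι : Type*} [Fintype ι] {X : ι → Type*} [∀ i, MeasurableSpace (X i)]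

theorem pi_le_pi_of_forall_le {μ ν : ∀ i, Measure (X i)} [∀ i, SigmaFinite (μ i)]
    (h : ∀ i, μ i ≤ ν i) : Measure.pi μ ≤ Measure.pi ν := by
  refine Measure.le_iff.2 fun s hs => ?_
  rw [Measure.pi, Measure.pi, ← Measure.pi, toMeasure_apply _ _ hs]
  exact OuterMeasure.le_pi.2 (fun t _ => by
    rw [Measure.coe_toOuterMeasure, Measure.pi_pi]
    exact Finset.prod_le_prod' fun i _ => h i (t i)) s

theorem pi_le_prod_smul_pi {μ ν : ∀ i, Measure (X i)} [∀ i, IsFiniteMeasure (μ i)]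
    [∀ i, IsFiniteMeasure (ν i)] {c : ι → ℝ≥0} (h : ∀ i, μ i ≤ c i • ν i) :
    Measure.pi μ ≤ (∏ i, c i) • Measure.pi ν := by
  refine (pi_le_pi_of_forall_le h).trans_eq (Measure.pi_eq fun s _ => ?_)
  simp only [Measure.smul_apply, ENNReal.smul_def, smul_eq_mul, Measure.pi_pi,
    Finset.prod_mul_distrib, ENNReal.ofNNReal_finsetProd]

theorem productMixture_pi [DecidableEq ι] {κ : Type*} [Fintype κ] (ρ : ∀ i, κ → Measure (X i))
    [∀ i y, IsFiniteMeasure (ρ i y)] (w : ι → κ → ℝ) :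
    productMixture (fun x => Measure.pi fun i => ρ i (x i)) w =
      Measure.pi fun i => ∑ y, ENNReal.ofReal (w i y) • ρ i y := by
  have hfin : ∀ i, IsFiniteMeasure (∑ y, ENNReal.ofReal (w i y) • ρ i y) := fun i =>
    ⟨by simp [Measure.finsetSum_apply, ENNReal.mul_lt_top_iff]⟩
  refine (Measure.pi_eq fun s _ => ?_).symm
  simp only [productMixture, Measure.finsetSum_apply, Measure.smul_apply, smul_eq_mul,
    Measure.pi_pi, Finset.prod_univ_sum, Fintype.piFinset_univ, Finset.prod_mul_distrib]

theorem map_snoc_prod_pi {r : ℕ} {M : Type*} [MeasurableSpace M] (μ : Fin (r + 1) → Measure M)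
    [∀ i, SigmaFinite (μ i)] :
    ((Measure.pi fun i : Fin r => μ i.castSucc).prod (μ (Fin.last r))).map
      (fun hm => (Fin.snoc hm.1 hm.2 : Fin (r + 1) → M)) = Measure.pi μ := by
  refine (Measure.pi_eq fun s hs => ?_).symm
  have hpre : (fun hm : (Fin r → M) × M => (Fin.snoc hm.1 hm.2 : Fin (r + 1) → M)) ⁻¹'
      Set.univ.pi s = (Set.univ.pi fun i : Fin r => s i.castSucc) ×ˢ s (Fin.last r) := by
    ext hm
    simp [Fin.forall_fin_succ']
  rw [Measure.map_apply (measurable_snoc r M) (.univ_pi hs), hpre, Measure.prod_prod,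
    Measure.pi_pi, Fin.prod_univ_castSucc]

theorem integral_sum_div_card_pi [Nonempty ι] {Ω : Type*} [MeasurableSpace Ω] {ρ : Measure Ω}
    [IsProbabilityMeasure ρ] {Y : Ω → ℝ} (hY : Integrable Y ρ) :
    ∫ t : ι → Ω, (∑ i, Y (t i)) / Fintype.card ι ∂(Measure.pi fun _ => ρ) = ∫ ω, Y ω ∂ρ := by
  rw [integral_div, integral_finsetSum _ fun i _ => integrable_comp_eval hY]
  simp [integral_comp_eval (μ := fun _ : ι => ρ) hY.aestronglyMeasurable]

theorem variance_sum_div_card_pi {Ω : Type*} [MeasurableSpace Ω] {ρ : Measure Ω}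
    [IsProbabilityMeasure ρ] {Y : Ω → ℝ} (hY : MemLp Y 2 ρ) :
    Var[fun t : ι → Ω => (∑ i, Y (t i)) / Fintype.card ι; Measure.pi fun _ => ρ] =
      Var[Y; ρ] / Fintype.card ι := by
  have hsum := variance_sum_pi (μ := fun _ : ι => ρ) (X := fun _ => Y) fun _ => hY
  simp only [Finset.sum_fn] at hsum
  simp only [div_eq_mul_inv, variance_mul_const, hsum]
  rcases isEmpty_or_nonempty ι
  · simp
  · simp only [Finset.sum_const, Finset.card_univ, nsmul_eq_mul]
    field_simp

end Pi

theorem flipLaw_le_smul {α : ℝ} (hα : 0 ≤ α) (b b' : Bool) :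
    flipLaw α b ≤ (Real.exp (α / 2)).toNNReal • flipLaw α b' := by
  have hE : 1 ≤ Real.exp (α / 2) := Real.one_le_exp (by linarith)
  refine Measure.le_iff.2 fun s _ => ?_
  rw [Measure.smul_apply, ENNReal.smul_def, smul_eq_mul]
  obtain rfl | rfl : b' = b ∨ b' = !b := by cases b <;> cases b' <;> simp
  · exact le_mul_of_one_le_left' (by exact_mod_cast Real.one_le_toNNReal.2 hE)
  have hkeep : ENNReal.ofReal (Real.exp (α / 2) / (Real.exp (α / 2) + 1)) ≤
      ENNReal.ofReal (Real.exp (α / 2)) * ENNReal.ofReal (1 / (Real.exp (α / 2) + 1)) := by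
    rw [← ENNReal.ofReal_mul (Real.exp_pos _).le, mul_one_div]
  have hflip : ENNReal.ofReal (1 / (Real.exp (α / 2) + 1)) ≤
      ENNReal.ofReal (Real.exp (α / 2)) *
        ENNReal.ofReal (Real.exp (α / 2) / (Real.exp (α / 2) + 1)) := by
    rw [← ENNReal.ofReal_mul (Real.exp_pos _).le, mul_div_assoc']
    exact ENNReal.ofReal_le_ofReal
      (div_le_div_of_nonneg_right (one_le_mul_of_one_le_of_one_le hE hE) (by positivity))
  simp only [flipLaw, Measure.add_apply, Measure.smul_apply, smul_eq_mul, Bool.not_not]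
  rw [mul_add, add_comm (_ * _) (_ * (_ * Measure.dirac b s)), ← mul_assoc, ← mul_assoc]
  exact add_le_add (mul_le_mul_left hkeep _) (mul_le_mul_left hflip _)

theorem rapporMsg_le_smul {α : ℝ} (hα : 0 ≤ α) {k : ℕ} (a c : Fin k) :
    rapporMsg α a ≤ (Real.exp α).toNNReal • rapporMsg α c := by
  set E := (Real.exp (α / 2)).toNNReal with hE
  have hE1 : 1 ≤ E := Real.one_le_toNNReal.2 (Real.one_le_exp (by linarith))
  have hEE : (Real.exp α).toNNReal = E * E := by
    rw [hE, ← Real.toNNReal_mul (Real.exp_pos _).le, ← Real.exp_add, add_halves]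
  have hbit : ∀ y, flipLaw α (decide (y = a)) ≤
      ((if y = a then E else 1) * if y = c then E else 1) • flipLaw α (decide (y = c)) := by
    intro y
    by_cases hy : (y = a ↔ y = c)
    · simp only [hy]
      refine Measure.le_iff.2 fun s _ => le_mul_of_one_le_left' ?_
      split_ifs
      · exact_mod_cast one_le_mul_of_one_le_of_one_le hE1 hE1
      · simp
    · have hone : ((if y = a then E else 1) * if y = c then E else 1) = E := by
        by_cases ha : y = a <;> by_cases hc : y = c <;> simp_all
      rw [hone]
      exact flipLaw_le_smul hα _ _
  refine (pi_le_prod_smul_pi hbit).trans_eq ?_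
  rw [Finset.prod_mul_distrib, hEE]
  simp [rapporMsg]

theorem kRappor_lawUpTo (α : ℝ) {k n : ℕ} (x : Fin n → Fin k) (r : ℕ) (h : r ≤ n) :
    (kRappor α k n).lawUpTo x r =
      (Measure.pi fun i : Fin r => rapporMsg α (x (Fin.castLE h i)) :
        Measure (Fin r → Fin k → Bool)) := by
  induction r with
  | zero => exact (Measure.pi_of_empty _ Fin.elim0).symm
  | succ r ih =>
    have hstep : (kRappor α k n).step r (((kRappor α k n).speaker r).map x) =
        Kernel.const (Fin r → Fin k → Bool) (rapporMsg α (x ⟨r, h⟩)) := by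
      rw [show (kRappor α k n).speaker r = some ⟨r, h⟩ from dif_pos h]
      rfl
    rw [Protocol.lawUpTo, hstep, ih (Nat.le_of_succ_le h)]
    refine Eq.trans ?_ (map_snoc_prod_pi fun i => rapporMsg α (x (Fin.castLE h i)))
    rw [← Measure.compProd_const]
    rfl

theorem kRappor_law (α : ℝ) {k n : ℕ} (x : Fin n → Fin k) :
    (kRappor α k n).law x =
      (Measure.pi fun i => rapporMsg α (x i) : Measure (Fin n → Fin k → Bool)) :=
  kRappor_lawUpTo α x n le_rfl

theorem kRappor_isLDP {α : ℝ} (hα : 0 ≤ α) (k n : ℕ) : (kRappor α k n).IsLDP α 0 := by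
  intro x i y O _
  have hmsg : ∀ j, rapporMsg α (x j) ≤
      (if j = i then (Real.exp α).toNNReal else 1) • rapporMsg α (Function.update x i y j) :=
    fun j => by
      rcases eq_or_ne j i with rfl | hj
      · simpa using rapporMsg_le_smul hα _ _
      · simp [hj]
  have hlaw := pi_le_prod_smul_pi hmsg
  rw [Finset.prod_ite_eq' Finset.univ i, if_pos (Finset.mem_univ i)] at hlaw
  rw [ENNReal.ofReal_zero, add_zero, kRappor_law, kRappor_law]
  exact hlaw O

/-- The law of the message of a `k`-RAPPOR user whose sample is drawn from `p`. -/
noncomputable def rapporMix (α : ℝ) {k : ℕ} (p : Fin k → ℝ) : Measure (Fin k → Bool) :=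
  ∑ x, ENNReal.ofReal (p x) • rapporMsg α x

theorem isProbabilityMeasure_rapporMix (α : ℝ) {k : ℕ} {p : Fin k → ℝ}
    (hp : p ∈ stdSimplex ℝ (Fin k)) : IsProbabilityMeasure (rapporMix α p) := by
  constructor
  simp only [rapporMix, Measure.finsetSum_apply, Measure.smul_apply, measure_univ, smul_eq_mul,
    mul_one]
  rw [← ENNReal.ofReal_sum_of_nonneg fun x _ => hp.1 x, hp.2, ENNReal.ofReal_one]

theorem kRappor_lawUnder (α : ℝ) {k : ℕ} (n : ℕ) (p : Fin k → ℝ) :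
    (kRappor α k n).lawUnder p =
      (Measure.pi fun _ => rapporMix α p : Measure (Fin n → Fin k → Bool)) := by
  rw [Protocol.lawUnder_eq_productMixture, funext (kRappor_law α)]
  exact productMixture_pi (fun _ => rapporMsg α) fun _ => p

/-- The probability that a bit of a `k`-RAPPOR message is set when the element it stands for has
probability `q`. -/
noncomputable def bitProb (α q : ℝ) : ℝ :=
  (q * (Real.exp (α / 2) - 1) + 1) / (Real.exp (α / 2) + 1)

theorem integral_flipLaw (α : ℝ) (d : Bool) :
    ∫ b, (if b then (1 : ℝ) else 0) ∂(flipLaw α d) = bitProb α (if d then 1 else 0) := by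
  have hkeep : 0 ≤ Real.exp (α / 2) / (Real.exp (α / 2) + 1) := by positivity
  have hflip : 0 ≤ 1 / (Real.exp (α / 2) + 1) := by positivity
  rw [flipLaw, integral_add_measure (Integrable.of_finite.smul_measure ENNReal.ofReal_ne_top)
      (Integrable.of_finite.smul_measure ENNReal.ofReal_ne_top), integral_smul_measure,
    integral_smul_measure, integral_dirac, integral_dirac, ENNReal.toReal_ofReal hkeep,
    ENNReal.toReal_ofReal hflip]
  cases d <;> simp [bitProb]

theorem integral_bit_rapporMsg (α : ℝ) {k : ℕ} (x y : Fin k) :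
    ∫ b, (if b y then (1 : ℝ) else 0) ∂(rapporMsg α x) = bitProb α (if y = x then 1 else 0) := by
  have hflip := integral_flipLaw α (decide (y = x))
  simp only [decide_eq_true_eq] at hflip
  rw [← hflip, rapporMsg]
  exact integral_comp_eval (μ := fun y => flipLaw α (decide (y = x))) (i := y)
    (f := fun b : Bool => if b then (1 : ℝ) else 0) .of_discrete

theorem integral_bit_rapporMix (α : ℝ) {k : ℕ} {p : Fin k → ℝ} (hp : p ∈ stdSimplex ℝ (Fin k))
    (y : Fin k) : ∫ b, (if b y then (1 : ℝ) else 0) ∂(rapporMix α p) = bitProb α (p y) := by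
  rw [rapporMix, integral_finsetSum_measure fun _ _ =>
    Integrable.of_finite.smul_measure ENNReal.ofReal_ne_top]
  simp only [integral_smul_measure, ENNReal.toReal_ofReal (hp.1 _), integral_bit_rapporMsg,
    smul_eq_mul, bitProb, mul_div_assoc', ← Finset.sum_div]
  simp [mul_add, Finset.sum_add_distrib, hp.2]

theorem variance_eq_integral_mul_one_sub_of_sq_eq_self {Ω : Type*} [MeasurableSpace Ω]
    {μ : Measure Ω} [IsProbabilityMeasure μ] {Y : Ω → ℝ} (hY : MemLp Y 2 μ) (hsq : Y ^ 2 = Y) :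
    Var[Y; μ] = (∫ ω, Y ω ∂μ) * (1 - ∫ ω, Y ω ∂μ) := by
  rw [variance_eq_sub hY, hsq]
  ring

theorem variance_bit_rapporMix (α : ℝ) {k : ℕ} {p : Fin k → ℝ} (hp : p ∈ stdSimplex ℝ (Fin k))
    (y : Fin k) :
    Var[fun b => if b y then (1 : ℝ) else 0; rapporMix α p] =
      bitProb α (p y) * (1 - bitProb α (p y)) := by
  have := isProbabilityMeasure_rapporMix α hp
  rw [variance_eq_integral_mul_one_sub_of_sq_eq_self .of_discrete (by ext b; simp),
    integral_bit_rapporMix α hp]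

theorem integral_abs_sub_integral_le_sqrt_variance {Ω : Type*} [MeasurableSpace Ω] {μ : Measure Ω}
    [IsProbabilityMeasure μ] {Y : Ω → ℝ} (hY : MemLp Y 2 μ) :
    ∫ ω, |Y ω - ∫ ω', Y ω' ∂μ| ∂μ ≤ √Var[Y; μ] := by
  have hcentred : MemLp (fun ω => |Y ω - ∫ ω', Y ω' ∂μ|) 2 μ := (hY.sub (memLp_const _)).abs
  have hvar := variance_nonneg (fun ω => |Y ω - ∫ ω', Y ω' ∂μ|) μ
  rw [variance_eq_sub hcentred] at hvar
  simp only [Pi.pow_apply, sq_abs] at hvar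
  rw [← variance_eq_integral hY.aemeasurable] at hvar
  exact Real.le_sqrt_of_sq_le (by linarith)

section Unbiased

variable {k n : ℕ} {A : Protocol k n} {p : Fin k → ℝ}

theorem Protocol.risk_le_sum_sqrt_variance [IsProbabilityMeasure (A.lawUnder p)]
    (hmean : ∀ y, ∫ t, A.est t y ∂(A.lawUnder p) = p y)
    (hmem : ∀ y, MemLp (fun t => A.est t y) 2 (A.lawUnder p)) :
    A.risk p ≤ ENNReal.ofReal (∑ y, √Var[fun t => A.est t y; A.lawUnder p]) := by
  have hint : ∀ y, Integrable (fun t => |A.est t y - p y|) (A.lawUnder p) := fun y =>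
    (((hmem y).integrable one_le_two).sub (integrable_const _)).abs
  rw [Protocol.risk,
    ← ofReal_integral_eq_lintegral_ofReal (integrable_finsetSum _ fun y _ => hint y)
      (.of_forall fun t => Finset.sum_nonneg fun y _ => abs_nonneg _),
    integral_finsetSum _ fun y _ => hint y]
  refine ENNReal.ofReal_le_ofReal (Finset.sum_le_sum fun y _ => ?_)
  simpa only [hmean y] using integral_abs_sub_integral_le_sqrt_variance (hmem y)

theorem Protocol.sum_variance_le_collisionError [IsProbabilityMeasure (A.lawUnder p)]
    (hmean : ∀ y, ∫ t, A.est t y ∂(A.lawUnder p) = p y)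
    (hmem : ∀ y, MemLp (fun t => A.est t y) 2 (A.lawUnder p)) :
    ENNReal.ofReal (∑ y, Var[fun t => A.est t y; A.lawUnder p]) ≤ A.collisionError p := by
  have hint : ∀ y, Integrable (fun t => A.est t y ^ 2) (A.lawUnder p) := fun y =>
    (hmem y).integrable_sq
  have hcollision : Integrable (fun t => collision (A.est t)) (A.lawUnder p) :=
    integrable_finsetSum _ fun y _ => hint y
  have hbias : ∑ y, Var[fun t => A.est t y; A.lawUnder p] =
      ∫ t, (collision (A.est t) - collision p) ∂(A.lawUnder p) := by
    rw [integral_sub hcollision (integrable_const _), integral_const, probReal_univ, one_smul]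
    simp only [collision]
    rw [integral_finsetSum _ fun y _ => hint y, ← Finset.sum_sub_distrib]
    refine Finset.sum_congr rfl fun y _ => ?_
    rw [variance_eq_sub (hmem y), hmean y]
    rfl
  have hdiff : Integrable (fun t => |collision (A.est t) - collision p|) (A.lawUnder p) :=
    (hcollision.sub (integrable_const _)).abs
  rw [Protocol.collisionError, ← ofReal_integral_eq_lintegral_ofReal hdiff
    (.of_forall fun t => abs_nonneg _), hbias]
  exact ENNReal.ofReal_le_ofReal ((le_abs_self _).trans abs_integral_le_integral_abs)

end Unbiased

section Moments

variable {α : ℝ} {k n : ℕ} {p : Fin k → ℝ}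

instance : Finite (Fin (kRappor α k n).rounds → (kRappor α k n).Msg) :=
  inferInstanceAs (Finite (Fin n → Fin k → Bool))

instance : DiscreteMeasurableSpace (Fin (kRappor α k n).rounds → (kRappor α k n).Msg) :=
  inferInstanceAs (DiscreteMeasurableSpace (Fin n → Fin k → Bool))

theorem isProbabilityMeasure_kRappor_lawUnder (α : ℝ) (n : ℕ) (hp : p ∈ stdSimplex ℝ (Fin k)) :
    IsProbabilityMeasure ((kRappor α k n).lawUnder p) := by
  rw [Protocol.lawUnder_eq_productMixture]
  exact isProbabilityMeasure_productMixture _ fun _ => hp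

theorem integral_kRappor_est (hα : α ≠ 0) (hn : n ≠ 0) (hp : p ∈ stdSimplex ℝ (Fin k))
    (y : Fin k) :
    ∫ t, (kRappor α k n).est t y ∂((kRappor α k n).lawUnder p) = p y := by
  have := isProbabilityMeasure_rapporMix α hp
  have : Nonempty (Fin n) := ⟨⟨0, Nat.pos_of_ne_zero hn⟩⟩
  have hu : Real.exp (α / 2) - 1 ≠ 0 := by
    simpa [sub_eq_zero, Real.exp_eq_one_iff] using hα
  have hmean := integral_sum_div_card_pi (ι := Fin n) (ρ := rapporMix α p)
    (Y := fun b => if b y then (1 : ℝ) else 0) .of_finite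
  rw [integral_bit_rapporMix α hp, Fintype.card_fin] at hmean
  rw [kRappor_lawUnder]
  refine (integral_sub (α := Fin n → Fin k → Bool) .of_finite .of_finite).trans ?_
  rw [integral_const_mul, hmean, integral_const, probReal_univ, one_smul, bitProb]
  have hv : Real.exp (α / 2) + 1 ≠ 0 := by positivity
  field_simp
  ring

theorem variance_kRappor_est (hα : α ≠ 0) (hp : p ∈ stdSimplex ℝ (Fin k)) (y : Fin k) :
    Var[fun t => (kRappor α k n).est t y; (kRappor α k n).lawUnder p] =
      (p y * (Real.exp (α / 2) - 1) + 1) * ((1 - p y) * (Real.exp (α / 2) - 1) + 1) /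
        ((Real.exp (α / 2) - 1) ^ 2 * n) := by
  have := isProbabilityMeasure_rapporMix α hp
  have hu : Real.exp (α / 2) - 1 ≠ 0 := by
    simpa [sub_eq_zero, Real.exp_eq_one_iff] using hα
  have hvar := variance_sum_div_card_pi (ι := Fin n) (ρ := rapporMix α p)
    (Y := fun b => if b y then (1 : ℝ) else 0) .of_discrete
  rw [variance_bit_rapporMix α hp, Fintype.card_fin] at hvar
  have hest : Var[fun t => (kRappor α k n).est t y; (kRappor α k n).lawUnder p] =
      Var[fun t : Fin n → Fin k → Bool =>
        (Real.exp (α / 2) + 1) / (Real.exp (α / 2) - 1) *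
          ((∑ i, if t i y then (1 : ℝ) else 0) / n) - 1 / (Real.exp (α / 2) - 1);
        Measure.pi fun _ => rapporMix α p] := by
    rw [kRappor_lawUnder]
    rfl
  rw [hest, variance_sub_const Measurable.of_discrete.aestronglyMeasurable, variance_const_mul,
    hvar, bitProb]
  have hv : Real.exp (α / 2) + 1 ≠ 0 := by positivity
  field_simp
  ring

theorem exp_half_sub_one_mem_Icc (hα0 : 0 ≤ α) (hα1 : α ≤ 1) :
    Real.exp (α / 2) - 1 ∈ Set.Icc (α / 2) α := by
  have hupper := Real.abs_exp_sub_one_le (x := α / 2) (by rw [abs_of_nonneg] <;> linarith)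
  rw [abs_of_nonneg (by linarith : 0 ≤ α / 2)] at hupper
  exact ⟨by linarith [Real.add_one_le_exp (α / 2)],
    by linarith [le_abs_self (Real.exp (α / 2) - 1)]⟩

theorem variance_kRappor_est_le (hα0 : 0 < α) (hα1 : α ≤ 1) (hn : n ≠ 0)
    (hp : p ∈ stdSimplex ℝ (Fin k)) (y : Fin k) :
    Var[fun t => (kRappor α k n).est t y; (kRappor α k n).lawUnder p] ≤ 9 / (α ^ 2 * n) := by
  rw [variance_kRappor_est hα0.ne' hp]
  obtain ⟨hlower, hupper⟩ := exp_half_sub_one_mem_Icc hα0.le hα1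
  set u := Real.exp (α / 2) - 1
  have hnum : (p y * u + 1) * ((1 - p y) * u + 1) ≤ 9 / 4 := by
    nlinarith [sq_nonneg (p y * u - (1 - p y) * u)]
  calc _ ≤ (9 / 4) / ((α / 2) ^ 2 * n) := by gcongr
    _ = 9 / (α ^ 2 * n) := by field_simp; norm_num

theorem le_variance_kRappor_est (hα0 : 0 < α) (hα1 : α ≤ 1)
    (hp : p ∈ stdSimplex ℝ (Fin k)) (y : Fin k) :
    1 / (α ^ 2 * n) ≤ Var[fun t => (kRappor α k n).est t y; (kRappor α k n).lawUnder p] := by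
  rw [variance_kRappor_est hα0.ne' hp]
  obtain ⟨hlower, hupper⟩ := exp_half_sub_one_mem_Icc hα0.le hα1
  set u := Real.exp (α / 2) - 1
  rcases n.eq_zero_or_pos with rfl | hn
  · simp
  have hu : 0 < u := by linarith
  have hp0 : 0 ≤ p y * u := mul_nonneg (hp.1 y) hu.le
  have hp1 : 0 ≤ (1 - p y) * u :=
    mul_nonneg (sub_nonneg.2 (mem_Icc_of_mem_stdSimplex hp y).2) hu.le
  have hnum : 1 ≤ (p y * u + 1) * ((1 - p y) * u + 1) :=
    one_le_mul_of_one_le_of_one_le (by linarith) (by linarith)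
  gcongr

theorem kRappor_worstRisk_le (hα0 : 0 < α) (hα1 : α ≤ 1) (hn : n ≠ 0) :
    (kRappor α k n).worstRisk ≤ ENNReal.ofReal (k * (3 / (α * √n))) := by
  refine iSup₂_le fun p hp => ?_
  have := isProbabilityMeasure_kRappor_lawUnder α n hp
  refine (Protocol.risk_le_sum_sqrt_variance (integral_kRappor_est hα0.ne' hn hp)
    fun _ => .of_discrete).trans (ENNReal.ofReal_le_ofReal ?_)
  have hsq : 9 / (α ^ 2 * n) = (3 / (α * √n)) ^ 2 := by
    rw [div_pow, mul_pow, Real.sq_sqrt n.cast_nonneg]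
    norm_num
  calc ∑ y, √Var[fun t => (kRappor α k n).est t y; (kRappor α k n).lawUnder p]
      ≤ ∑ _y : Fin k, 3 / (α * √n) := Finset.sum_le_sum fun y _ =>
        Real.sqrt_le_iff.2 ⟨by positivity, hsq ▸ variance_kRappor_est_le hα0 hα1 hn hp y⟩
    _ = k * (3 / (α * √n)) := by simp

theorem le_kRappor_collisionError (hα0 : 0 < α) (hα1 : α ≤ 1) (hn : n ≠ 0)
    (hp : p ∈ stdSimplex ℝ (Fin k)) :
    ENNReal.ofReal (k * (1 / (α ^ 2 * n))) ≤ (kRappor α k n).collisionError p := by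
  have := isProbabilityMeasure_kRappor_lawUnder α n hp
  refine le_trans (ENNReal.ofReal_le_ofReal ?_) (Protocol.sum_variance_le_collisionError
    (integral_kRappor_est hα0.ne' hn hp) fun _ => .of_discrete)
  calc (k : ℝ) * (1 / (α ^ 2 * n)) = ∑ _y : Fin k, 1 / (α ^ 2 * n) := by simp
    _ ≤ _ := Finset.sum_le_sum fun y _ => le_variance_kRappor_est hα0 hα1 hp y

end Moments

section Optimality

variable {α : ℝ} {k : ℕ}

theorem Protocol.IsLDP.le_worstRisk_of_le {n : ℕ} {B : Protocol k n} (hB : B.IsLDP α 0)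
    (hα0 : 0 < α) (hα1 : α ≤ 1) (hk : 2 ≤ k) {γ : ℝ} (hγ0 : 0 ≤ γ) (hγ1 : γ ≤ 1)
    (hγ : 84 * (γ * (α * √n)) ≤ k) : ENNReal.ofReal (3 / 4 * γ) ≤ B.worstRisk := by
  obtain ⟨e⟩ : Nonempty (Fin (k / 2) × Bool ↪ Fin k) :=
    Function.Embedding.nonempty_of_card_le (by simp; omega)
  have : Nonempty (Fin (k / 2)) := ⟨⟨0, by omega⟩⟩
  refine hB.le_worstRisk hα0.le e hγ0 hγ1 ?_
  have hexp : Real.exp α ≤ 3 := (Real.exp_le_exp.2 hα1).trans Real.exp_one_lt_three.le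
  have hexp_sub : Real.exp α - 1 ≤ 2 * α := by
    have := Real.abs_exp_sub_one_le (x := α) (by rwa [abs_of_pos hα0])
    rw [abs_of_pos hα0] at this
    exact (le_abs_self _).trans this
  have hexp_nonneg : 0 ≤ Real.exp α - 1 := by linarith [Real.add_one_le_exp α]
  have hhalf : (k : ℝ) ≤ 3 * (k / 2 : ℕ) := by exact_mod_cast (by omega : k ≤ 3 * (k / 2))
  have hd : (0 : ℝ) < (k / 2 : ℕ) := by exact_mod_cast (by omega : 0 < k / 2)
  have hratio : γ / (k / 2 : ℕ) * (α * √n) ≤ 1 / 28 := by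
    rw [div_mul_eq_mul_div, div_le_iff₀ hd]
    linarith
  rw [Fintype.card_fin]
  calc 64 * (Real.exp α * (n * (γ / (k / 2 : ℕ) * (Real.exp α - 1)) ^ 2))
      ≤ 64 * (3 * (n * (γ / (k / 2 : ℕ) * (2 * α)) ^ 2)) := by gcongr
    _ = 768 * (γ / (k / 2 : ℕ) * (α * √n)) ^ 2 := by
      rw [mul_pow _ (α * √n), mul_pow α, Real.sq_sqrt n.cast_nonneg]
      ring
    _ ≤ 768 * (1 / 28) ^ 2 := by gcongr
    _ ≤ 1 := by norm_num

theorem min_worstRisk_kRappor_le {n : ℕ} (hα0 : 0 < α) (hα1 : α ≤ 1) (hk : 2 ≤ k) (hn : n ≠ 0)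
    {B : Protocol k n} (hB : B.IsLDP α 0) :
    min 2 (kRappor α k n).worstRisk ≤ ENNReal.ofReal 336 * B.worstRisk := by
  rcases le_or_gt (84 * (α * √n)) k with h | h
  · have hB1 := hB.le_worstRisk_of_le hα0 hα1 hk zero_le_one le_rfl (by linarith)
    calc min 2 (kRappor α k n).worstRisk ≤ 2 := min_le_left _ _
      _ = ENNReal.ofReal 2 := by simp
      _ ≤ ENNReal.ofReal (336 * (3 / 4 * 1)) := ENNReal.ofReal_le_ofReal (by norm_num)
      _ = ENNReal.ofReal 336 * ENNReal.ofReal (3 / 4 * 1) := ENNReal.ofReal_mul (by norm_num)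
      _ ≤ _ := mul_le_mul_right hB1 _
  · have hBγ := hB.le_worstRisk_of_le (γ := k / (84 * (α * √n))) hα0 hα1 hk (by positivity)
      ((div_le_one (by positivity)).2 h.le) (by field_simp; rfl)
    calc min 2 (kRappor α k n).worstRisk ≤ (kRappor α k n).worstRisk := min_le_right _ _
      _ ≤ ENNReal.ofReal (k * (3 / (α * √n))) := kRappor_worstRisk_le hα0 hα1 hn
      _ = ENNReal.ofReal (336 * (3 / 4 * (k / (84 * (α * √n))))) := by
        congr 1
        field_simp
        norm_num
      _ = ENNReal.ofReal 336 * ENNReal.ofReal (3 / 4 * (k / (84 * (α * √n)))) :=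
        ENNReal.ofReal_mul (by norm_num)
      _ ≤ _ := mul_le_mul_right hBγ _

theorem Protocol.IsLDP.card_le_of_worstRisk_le {m : ℕ} {B : Protocol k m} (hB : B.IsLDP α 0)
    (hα0 : 0 < α) (hα1 : α ≤ 1) (hk : 2 ≤ k) {τ : ℝ} (hτ0 : 0 ≤ τ) (hτ : τ ≤ 1 / 2)
    (hBτ : B.worstRisk ≤ ENNReal.ofReal τ) : k ≤ 112 * (τ * (α * √m)) := by
  have hlow : ∀ γ : ℝ, 0 ≤ γ → γ ≤ 1 → 84 * (γ * (α * √m)) ≤ k → 3 / 4 * γ ≤ τ :=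
    fun γ h0 h1 h => (ENNReal.ofReal_le_ofReal_iff hτ0).1
      ((hB.le_worstRisk_of_le hα0 hα1 hk h0 h1 h).trans hBτ)
  have hlarge : (k : ℝ) < 84 * (α * √m) := by
    by_contra! h
    linarith [hlow 1 zero_le_one le_rfl (by linarith)]
  have hd : 0 < 84 * (α * √m) := (Nat.cast_nonneg k).trans_lt hlarge
  have hτ' := hlow (k / (84 * (α * √m))) (by positivity) ((div_le_one hd).2 hlarge.le)
    (by rw [mul_left_comm, div_mul_cancel₀ _ hd.ne'])
  rw [mul_div_assoc', div_le_iff₀ hd] at hτ'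
  linarith

theorem worstRisk_kRappor_le_of_le {m n : ℕ} (hα0 : 0 < α) (hα1 : α ≤ 1) (hk : 2 ≤ k) {τ : ℝ}
    (hτ0 : 0 ≤ τ) (hτ : τ ≤ 1 / 2) {B : Protocol k m} (hB : B.IsLDP α 0)
    (hBτ : B.worstRisk ≤ ENNReal.ofReal τ) (hn : 336 ^ 2 * (m : ℝ) ≤ n) :
    (kRappor α k n).worstRisk ≤ ENNReal.ofReal τ := by
  have hcard := hB.card_le_of_worstRisk_le hα0 hα1 hk hτ0 hτ hBτ
  have hsqrt : 336 * √m ≤ √n := by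
    refine Real.le_sqrt_of_sq_le ?_
    rwa [mul_pow, Real.sq_sqrt m.cast_nonneg]
  have hn0 : n ≠ 0 := by
    rintro rfl
    have hm : √(m : ℝ) = 0 := by
      rw [Nat.cast_zero, Real.sqrt_zero] at hsqrt
      linarith [Real.sqrt_nonneg (m : ℝ)]
    rw [hm, mul_zero, mul_zero, mul_zero] at hcard
    exact absurd (by exact_mod_cast hcard : k ≤ 0) (by omega)
  refine (kRappor_worstRisk_le hα0 hα1 hn0).trans (ENNReal.ofReal_le_ofReal ?_)
  rw [mul_div_assoc', div_le_iff₀ (by positivity)]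
  calc (k : ℝ) * 3 ≤ 112 * (τ * (α * √m)) * 3 := by gcongr
    _ = τ * (α * (336 * √m)) := by ring
    _ ≤ τ * (α * √n) := by gcongr

theorem isMinimaxOptimalWithin_kRappor (hα0 : 0 < α) (hα1 : α ≤ 1) (hk : 2 ≤ k) :
    IsMinimaxOptimalWithin (336 ^ 2) α 0 (kRappor α k) where
  isLDP := kRappor_isLDP hα0.le k
  risk_le n hn _ hB :=
    (min_worstRisk_kRappor_le hα0 hα1 hk (Nat.one_le_iff_ne_zero.1 hn) hB).trans
      (mul_le_mul_left (ENNReal.ofReal_le_ofReal (by norm_num)) _)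
  samples_le _ hτ0 hτ _ _ hB hBτ _ hn :=
    worstRisk_kRappor_le_of_le hα0 hα1 hk hτ0.le hτ hB hBτ hn

theorem div_le_of_kRappor_collisionError_le {n : ℕ} (hα0 : 0 < α) (hα1 : α ≤ 1) (hn : n ≠ 0)
    {p : Fin k → ℝ} (hp : p ∈ stdSimplex ℝ (Fin k)) {ε : ℝ} (hε : 0 < ε)
    (h : (kRappor α k n).collisionError p ≤ ENNReal.ofReal ε) : k / (α ^ 2 * ε) ≤ n := by
  have hbias := (ENNReal.ofReal_le_ofReal_iff hε.le).1
    ((le_kRappor_collisionError hα0 hα1 hn hp).trans h)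
  rw [mul_one_div, div_le_iff₀ (by positivity)] at hbias
  rw [div_le_iff₀ (by positivity)]
  linarith

end Optimality

theorem uniform_mem_stdSimplex {k : ℕ} (hk : k ≠ 0) : uniform k ∈ stdSimplex ℝ (Fin k) :=
  ⟨fun _ => by unfold uniform; positivity, by simp [uniform, hk]⟩

end LDP

theorem theorem4_general :
    ∃ K : ℝ, 0 < K ∧ ∀ α : ℝ, 0 < α → α ≤ 1 → ∀ k : ℕ, 2 ≤ k →
      LDP.IsMinimaxOptimalWithin K α 0 (LDP.kRappor α k) ∧
      ∀ p ∈ stdSimplex ℝ (Fin k), ∀ n : ℕ, 1 ≤ n → ∀ ε : ℝ, 0 < ε →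
        (LDP.kRappor α k n).collisionError p ≤ ENNReal.ofReal ε → k / (α ^ 2 * ε) ≤ n :=
  ⟨336 ^ 2, by norm_num, fun _ hα0 hα1 _ hk =>
    ⟨LDP.isMinimaxOptimalWithin_kRappor hα0 hα1 hk, fun _ hp _ hn _ hε h =>
      LDP.div_le_of_kRappor_collisionError_le hα0 hα1 (Nat.one_le_iff_ne_zero.1 hn) hp hε h⟩⟩

theorem theorem4 :
    ∃ K : ℝ, 0 < K ∧ ∃ c : ℝ, 0 < c ∧
      ∀ α : ℝ, 0 < α → α < 1 → ∀ k : ℕ, 2 ≤ k →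
        LDP.IsMinimaxOptimalWithin K α 0 (LDP.kRappor α k) ∧
        LDP.uniform k ∈ stdSimplex ℝ (Fin k) ∧
        ∀ n : ℕ, 1 ≤ n → ∀ ε : ℝ, 0 < ε →
          (LDP.kRappor α k n).collisionError (LDP.uniform k) ≤ ENNReal.ofReal ε →
            c * min ((k : ℝ) ^ 2 / α ^ 2) (k / (α ^ 2 * ε)) ≤ n := by
  obtain ⟨K, hK, h⟩ := theorem4_general
  refine ⟨K, hK, 1, one_pos, fun α hα0 hα1 k hk => ?_⟩
  obtain ⟨hoptimal, hcollision⟩ := h α hα0 hα1.le k hk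
  have hunif := LDP.uniform_mem_stdSimplex (k := k) (by omega)
  refine ⟨hoptimal, hunif, fun n hn ε hε herr => ?_⟩
  rw [one_mul]
  exact (min_le_right _ _).trans (hcollision _ hunif n hn ε hε herr)
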